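/- Let $M>0$ and let $l\ge 0$ be an integer. For $u\in\mathbb R$ let $r=r(u)\in(2M,\infty)$ be the unique solution of $u=r+2M\log\left(\frac{r}{2M}-1\right)$, and put $$V_l(u)=\left(1-\frac{2M}{r}\right)\left(\frac{2M}{r^3}+\frac{l(l+1)}{r^2}\right).$$ For $\omega\in\mathbb C$ consider the radial equation on all of $\mathbb R$, $$-\phi''(u)+\bigl(-\omega^2+V_l(u)\bigr)\phi(u)=0,\qquad \phi:\mathbb R\to\mathbb C. \tag{$*_\omega$}$$ Let $E=\{\omega\in\mathbb C:\operatorname{Im}\omega\le 0,\ \omega\ne 0\}$. For every $\omega\in E$ there is a unique solution $\grave\phi_\omega$ of $(*_\omega)$ with $$\lim_{u\to+\infty}e^{i\omega u}\grave\phi_\omega(u)=1,\qquad \lim_{u\to+\infty}\bigl(e^{i\omega u}\grave\phi_\omega(u)\bigr)'=0 .$$ Moreover, there is a solution $\phi_0$ of $(*_0)$ with the asymptotics $$\lim_{u\to\infty}u^l\phi_0(u)=i^l\,\frac{2^l\sqrt\pi}{\Gamma\left(\frac12-l\right)}=(-i)^l\,(2l-1)!!,$$ where $(2l-1)!!=(2l-1)(2l-3)\cdots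 3\cdot 1$ for $l\ge 1$ and $(2l-1)!!=1$ for $l=0$, and such that for all $u\in\mathbb R$ $$\phi_0(u)=\lim_{E\ni\omega\to 0}\omega^l\,\grave\phi_\omega(u)\qquad\text{and}\qquad \phi_0'(u)=\lim_{E\ni\omega\to 0}\omega^l\,\grave\phi_\omega'(u).$$ -/

import Mathlib

open Filter Topology

namespace Schwarzschild

/-- The Regge-Wheeler coordinate `u(r) = r + 2M log (r/(2M) - 1)`, meant for `r > 2M`. -/
noncomputable def reggeWheeler (M r : ℝ) : ℝ :=
  r + 2 * M * Real.log (r / (2 * M) - 1)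

/-- The area radius `r ∈ (2M, ∞)` as a function of the Regge-Wheeler coordinate `u ∈ ℝ`, i.e.
the inverse of `reggeWheeler M` on `(2M, ∞)`. -/
noncomputable def radius (M u : ℝ) : ℝ :=
  Function.invFunOn (reggeWheeler M) (Set.Ioi (2 * M)) u

/-- The Regge-Wheeler coordinate is a bijection from `(2M, ∞)` onto `ℝ`. -/
theorem reggeWheeler_bijOn {M : ℝ} (hM : 0 < M) :
    Set.BijOn (reggeWheeler M) (Set.Ioi (2 * M)) Set.univ := by
  refine ⟨fun _ _ => Set.mem_univ _, ?_, ?_⟩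
  · refine StrictMonoOn.injOn ?_
    intro a ha b _ hab
    have ha' : 2 * M < a := ha
    have h0 : 0 < a / (2 * M) - 1 := by
      rw [sub_pos, lt_div_iff₀ (by positivity)]
      linarith
    have h1 : a / (2 * M) - 1 < b / (2 * M) - 1 := by
      have : a / (2 * M) < b / (2 * M) := by gcongr
      linarith
    have h2 := Real.log_lt_log h0 h1
    have h3 : 2 * M * Real.log (a / (2 * M) - 1) < 2 * M * Real.log (b / (2 * M) - 1) := by
      gcongr
    unfold reggeWheeler
    linarith
  · intro u _
    have hc : Continuous fun y : ℝ => 2 * M * (1 + Real.exp y) + 2 * M * y := by fun_prop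
    have hid : Tendsto (fun y : ℝ => 2 * M * y) atTop atTop :=
      tendsto_id.const_mul_atTop (by positivity)
    have hid' : Tendsto (fun y : ℝ => 2 * M * y) atBot atBot :=
      tendsto_id.const_mul_atBot (by positivity)
    have htop : Tendsto (fun y : ℝ => 2 * M * (1 + Real.exp y) + 2 * M * y) atTop atTop := by
      refine tendsto_atTop_mono (fun y => ?_) hid
      have : 0 < 2 * M * (1 + Real.exp y) := by positivity
      linarith
    have hbot : Tendsto (fun y : ℝ => 2 * M * (1 + Real.exp y) + 2 * M * y) atBot atBot := by
      refine Tendsto.add_atBot (C := 2 * M * (1 + 0)) ?_ hid'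
      exact (tendsto_const_nhds.add Real.tendsto_exp_atBot).const_mul _
    obtain ⟨y, hy⟩ := hc.surjective htop hbot u
    refine ⟨2 * M * (1 + Real.exp y), ?_, ?_⟩
    · have : 0 < 2 * M * Real.exp y := by positivity
      simp only [Set.mem_Ioi]
      linarith
    · have h : 2 * M * (1 + Real.exp y) / (2 * M) - 1 = Real.exp y := by
        field_simp
        ring
      simp only [reggeWheeler, h, Real.log_exp]
      exact hy

/-- For `M > 0`, `radius M u` is a number `r > 2M` with Regge-Wheeler coordinate `u`. -/
theorem radius_spec {M : ℝ} (hM : 0 < M) (u : ℝ) :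
    2 * M < radius M u ∧ reggeWheeler M (radius M u) = u := by
  have h := (reggeWheeler_bijOn hM).surjOn (Set.mem_univ u)
  exact ⟨Function.invFunOn_mem h, Function.invFunOn_eq h⟩

/-- The potential `V_l(u) = (1 - 2M/r) (2M/r³ + l(l+1)/r²)` with `r = r(u)`. -/
noncomputable def potential (M : ℝ) (l : ℕ) (u : ℝ) : ℝ :=
  (1 - 2 * M / radius M u) *
    (2 * M / radius M u ^ 3 + (l : ℝ) * ((l : ℝ) + 1) / radius M u ^ 2)

/-- `φ : ℝ → ℂ` is a (twice differentiable) solution on all of `ℝ` of the radial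
Schrödinger equation `-φ'' + (-ω² + V_l) φ = 0`. -/
def IsRadialSolution (M : ℝ) (l : ℕ) (ω : ℂ) (φ : ℝ → ℂ) : Prop :=
  Differentiable ℝ φ ∧ Differentiable ℝ (deriv φ) ∧
    ∀ u : ℝ, -deriv (deriv φ) u + (-ω ^ 2 + (potential M l u : ℂ)) * φ u = 0

/-- `φ` is a solution of the radial equation with the boundary conditions at `+∞`
`lim e^{iωu} φ(u) = 1` and `lim (e^{iωu} φ(u))' = 0`. -/
def IsJostSolutionAtTop (M : ℝ) (l : ℕ) (ω : ℂ) (φ : ℝ → ℂ) : Prop :=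
  IsRadialSolution M l ω φ ∧
    Tendsto (fun u : ℝ => Complex.exp (Complex.I * ω * (u : ℂ)) * φ u) atTop (𝓝 1) ∧
    Tendsto (deriv fun u : ℝ => Complex.exp (Complex.I * ω * (u : ℂ)) * φ u) atTop (𝓝 0)

/-- The punctured closed lower half plane `E = {ω ∈ ℂ | Im ω ≤ 0, ω ≠ 0}`. -/
def lowerHalfPlane : Set ℂ := {ω : ℂ | ω.im ≤ 0 ∧ ω ≠ 0}

end Schwarzschild

/-! Near `+∞` the potential is the centrifugal term `l(l+1)/t²` plus a remainder `W = O(t^(-5/2))`.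
The equation without `W` has the explicit solution `h = e^{-iωt} θ_l(iωt) / t^l`, with `θ_l` the
reverse Bessel polynomial. It is entire in `ω`, satisfies `e^{iωt} h → (iω)^l` for `ω ≠ 0`, and
equals `(2l-1)!! t^{-l}` at `ω = 0`. The Jost solution is therefore `h` corrected and divided by
`(iω)^l`, and the factor `ω^l` in the theorem removes this singularity.

The correction is `φ = h g`. The equation becomes `(h² g')' = h² W g`, and `g → 1` turns it into the
Volterra equation `g = 1 + ∫_t^∞ h(τ)⁻² ∫_τ^∞ h² W g`. Two facts make this uniform on the closed
lower half plane, `ω = 0` included: `θ_l` has no zeros with `Re z ≥ 0` (`eval_besselTheta_ne_zero`),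
so `h` never vanishes, and `|h(s)| ≤ K |h(τ)|` for `s ≥ τ` (`exists_norm_freeSol_le`). Hence `g` is
bounded independently of `ω`, and dominated convergence gives `g_ω → g_0`
(`VolterraKernel.tendsto_solution`).

The Volterra equation lives on `t ≥ 1`. With `t = u - a` for arbitrary `a` it reaches every
half-line, and uniqueness of Jost solutions (`IsJostOn.unique`) glues the pieces. The limits at `ω =
0` inherit the compatibility. -/

namespace Schwarzschild

/-! ### Reverse Bessel polynomials and the location of their zeros -/

open Polynomial in
/-- The reverse Bessel polynomials. -/
noncomputable def besselTheta : ℕ → ℂ[X]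
  | 0 => 1
  | 1 => X + 1
  | n + 2 => C (2 * (n : ℂ) + 3) * besselTheta (n + 1) + X ^ 2 * besselTheta n

open Polynomial in
theorem besselTheta_add_two (n : ℕ) : besselTheta (n + 2) =
    C (2 * (n : ℂ) + 3) * besselTheta (n + 1) + X ^ 2 * besselTheta n := by
  rw [besselTheta]

open Polynomial in
/-- The Bessel polynomials, `besselTheta n` with reversed coefficients. -/
noncomputable def besselY : ℕ → ℂ[X]
  | 0 => 1
  | 1 => X + 1
  | n + 2 => C (2 * (n : ℂ) + 3) * X * besselY (n + 1) + besselY n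

open Polynomial in
theorem derivative_besselTheta_succ (n : ℕ) :
    derivative (besselTheta (n + 1)) = besselTheta (n + 1) - X * besselTheta n := by
  induction n using Nat.twoStepInduction with
  | zero => simp [besselTheta]
  | one => simp [besselTheta, C_ofNat]; ring
  | more n ih1 ih2 =>
    rw [besselTheta_add_two (n + 1)]
    simp only [derivative_add, derivative_mul, derivative_C, derivative_X_pow, ih1, ih2]
    rw [besselTheta_add_two n]
    simp [C_ofNat]
    ring

-- Equivalent to `e^{-z} z^{-n} θ_n(z)` solving `w'' = (1 + n(n+1)/z²) w`. The derivative formula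
-- and the recursion reduce everything to `θ_{n+1}` and `θ_n`.
open Polynomial in
theorem besselTheta_ode (n : ℕ) :
    X * derivative (derivative (besselTheta n)) =
      C 2 * (X + C (n : ℂ)) * derivative (besselTheta n) - C (2 * (n : ℂ)) * besselTheta n := by
  match n with
  | 0 => simp [besselTheta]
  | 1 => simp [besselTheta, C_ofNat]
  | n + 2 =>
    rw [derivative_besselTheta_succ, derivative_sub, derivative_mul, derivative_besselTheta_succ,
      derivative_besselTheta_succ, besselTheta_add_two n]
    simp [C_ofNat]
    ring

theorem natDegree_besselTheta_le (n : ℕ) : (besselTheta n).natDegree ≤ n := by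
  induction n using Nat.twoStepInduction with
  | zero => simp [besselTheta]
  | one => rw [besselTheta]; compute_degree
  | more n ih1 ih2 =>
    rw [besselTheta]
    compute_degree
    omega

/-- Truncated subtraction gives `0‼ = 1` at `n = 0`, which is the convention `(-1)!! = 1`. -/
theorem eval_zero_besselTheta (n : ℕ) :
    (besselTheta n).eval 0 = (Nat.doubleFactorial (2 * n - 1) : ℂ) := by
  induction n using Nat.twoStepInduction with
  | zero => simp [besselTheta]
  | one => simp [besselTheta]
  | more n ih1 ih2 =>
    have h : 2 * (n + 2) - 1 = (2 * (n + 1) - 1) + 2 := by omega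
    rw [besselTheta, h, Nat.doubleFactorial_add_two]
    simp only [Polynomial.eval_add, Polynomial.eval_mul, Polynomial.eval_C, ih2]
    have h' : 2 * (n + 1) - 1 + 2 = 2 * n + 3 := by omega
    rw [h']
    simp

theorem eval_zero_besselTheta_ne (n : ℕ) : (besselTheta n).eval 0 ≠ 0 := by
  rw [eval_zero_besselTheta]
  exact_mod_cast (Nat.doubleFactorial_pos _).ne'

theorem eval_zero_besselY (n : ℕ) : (besselY n).eval 0 = 1 := by
  induction n using Nat.twoStepInduction with
  | zero => simp [besselY]
  | one => simp [besselY]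
  | more n ih1 ih2 => simp [besselY, ih1]

/-- Transfers the behaviour of `θ_n` at infinity to that of `besselY n` at `0`. -/
theorem eval_besselTheta_eq (n : ℕ) {z : ℂ} (hz : z ≠ 0) :
    (besselTheta n).eval z = z ^ n * (besselY n).eval z⁻¹ := by
  induction n using Nat.twoStepInduction with
  | zero => simp [besselTheta, besselY]
  | one => simp [besselTheta, besselY, mul_add, hz, add_comm]
  | more n ih1 ih2 =>
    simp only [besselTheta, besselY, Polynomial.eval_add, Polynomial.eval_mul, Polynomial.eval_C,
      Polynomial.eval_pow, Polynomial.eval_X, ih1, ih2]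
    field_simp
    ring

theorem re_inv_pos {w : ℂ} (hw : 0 < w.re) : 0 < (w⁻¹).re := by
  rw [Complex.inv_re]
  refine div_pos hw (Complex.normSq_pos.2 ?_)
  rintro rfl
  simp at hw

/-- The reverse Bessel polynomials have all their zeros in the open left half plane. -/
theorem eval_besselTheta_ne_zero (n : ℕ) {z : ℂ} (hz : 0 ≤ z.re) :
    (besselTheta n).eval z ≠ 0 := by
  rcases eq_or_ne z 0 with rfl | hz0
  · exact eval_zero_besselTheta_ne n
  have hzi : 0 ≤ (z⁻¹).re := by
    rw [Complex.inv_re]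
    exact div_nonneg hz (Complex.normSq_nonneg _)
  -- The ratios `q_n = θ_{n+1} / (z θ_n)` satisfy `q_0 = 1 + 1/z` and `q_{n+1} = (2n+3)/z + 1/q_n`.
  -- Inversion preserves positive real part, so `Re q_n > 0` throughout, which forces `θ_{n+1}(z) ≠
  -- 0`.
  have key : ∀ n : ℕ, (besselTheta n).eval z ≠ 0 ∧
      0 < ((besselTheta (n + 1)).eval z / (z * (besselTheta n).eval z)).re := by
    intro n
    induction n with
    | zero =>
      refine ⟨by simp [besselTheta], ?_⟩
      have : (besselTheta 1).eval z / (z * (besselTheta 0).eval z) = 1 + z⁻¹ := by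
        simp [besselTheta]
        field_simp
      rw [zero_add, this, Complex.add_re, Complex.one_re]
      linarith
    | succ n ih =>
      obtain ⟨h0, h1⟩ := ih
      have h2 : (besselTheta (n + 1)).eval z ≠ 0 := by
        intro h
        simp [h] at h1
      refine ⟨h2, ?_⟩
      have : (besselTheta (n + 1 + 1)).eval z / (z * (besselTheta (n + 1)).eval z) =
          ((2 * n + 3 : ℝ) : ℂ) * z⁻¹ +
            ((besselTheta (n + 1)).eval z / (z * (besselTheta n).eval z))⁻¹ := by
        simp [besselTheta]
        field_simp
      rw [this, Complex.add_re, Complex.re_ofReal_mul]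
      have := re_inv_pos h1
      positivity
  exact (key n).1

/-- A complex polynomial without zeros in the closed right half plane is comparable along rays. -/
theorem exists_norm_eval_smul_le (p : Polynomial ℂ) (hp : ∀ z : ℂ, 0 ≤ z.re → p.eval z ≠ 0) :
    ∃ K : ℝ, 1 ≤ K ∧ ∀ z : ℂ, 0 ≤ z.re → ∀ c : ℝ, 1 ≤ c →
      ‖p.eval (c * z)‖ ≤ K * c ^ p.natDegree * ‖p.eval z‖ := by
  have hs := IsAlgClosed.splits p
  have hroot : ∀ a ∈ p.roots, a.re < 0 := by
    intro a ha
    by_contra h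
    exact hp a (not_lt.1 h) (Polynomial.isRoot_of_mem_roots ha)
  -- Factor by factor over the roots: `|cz - a| ≤ c(|z - a| + 2|a|)`, and `|z - a| ≥ -Re a > 0`
  -- absorbs `|a|`.
  have key : ∀ s : Multiset ℂ, (∀ a ∈ s, a.re < 0) → ∃ K : ℝ, 1 ≤ K ∧
      ∀ z : ℂ, 0 ≤ z.re → ∀ c : ℝ, 1 ≤ c →
      ‖(s.map fun a => c * z - a).prod‖ ≤ K * c ^ s.card * ‖(s.map fun a => z - a).prod‖ := by
    intro s
    induction s using Multiset.induction_on with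
    | empty => exact fun _ => ⟨1, le_rfl, by simp⟩
    | cons a s ih =>
      intro h
      obtain ⟨K, hK1, hK⟩ := ih fun b hb => h b (Multiset.mem_cons_of_mem hb)
      have ha : 0 < -a.re := neg_pos.2 (h a (Multiset.mem_cons_self a s))
      refine ⟨(1 + 2 * (‖a‖ / -a.re)) * K, ?_, fun z hz c hc => ?_⟩
      · have : 0 ≤ ‖a‖ / -a.re := by positivity
        nlinarith
      have h1 : -a.re ≤ ‖z - a‖ := by
        refine le_trans ?_ (Complex.re_le_norm _)
        simp [hz]
      have h2 : ‖a‖ ≤ ‖a‖ / -a.re * ‖z - a‖ := by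
        rw [div_mul_eq_mul_div, le_div_iff₀ ha]
        gcongr
      have h3 : ‖z‖ ≤ ‖z - a‖ + ‖a‖ := by
        simpa using norm_add_le (z - a) a
      have h4 : ‖(c : ℂ) * z - a‖ ≤ (1 + 2 * (‖a‖ / -a.re)) * c * ‖z - a‖ := by
        calc ‖(c : ℂ) * z - a‖ ≤ c * ‖z‖ + 1 * ‖a‖ := by
              refine (norm_sub_le _ _).trans ?_
              rw [norm_mul, Complex.norm_real, Real.norm_of_nonneg (by linarith), one_mul]
          _ ≤ c * ‖z‖ + c * ‖a‖ := by gcongr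
          _ = c * (‖z‖ + ‖a‖) := by ring
          _ ≤ c * ((1 + 2 * (‖a‖ / -a.re)) * ‖z - a‖) := by
              gcongr
              linarith
          _ = _ := by ring
      simp only [Multiset.map_cons, Multiset.prod_cons, norm_mul, Multiset.card_cons]
      calc _ ≤ ((1 + 2 * (‖a‖ / -a.re)) * c * ‖z - a‖) *
            (K * c ^ s.card * ‖(s.map fun a => z - a).prod‖) := by
              gcongr
              exact hK z hz c hc
        _ = _ := by ring
  obtain ⟨K, hK1, hK⟩ := key p.roots hroot
  refine ⟨K, hK1, fun z hz c hc => ?_⟩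
  rw [hs.eval_eq_prod_roots, hs.eval_eq_prod_roots, norm_mul, norm_mul, hs.natDegree_eq_card_roots]
  calc _ ≤ ‖p.leadingCoeff‖ *
        (K * c ^ p.roots.card * ‖(p.roots.map fun a => z - a).prod‖) := by
          gcongr
          exact hK z hz c hc
    _ = _ := by ring

end Schwarzschild

/-! ### The Volterra equation: weighted estimates and existence -/

namespace Schwarzschild

open MeasureTheory Set

section Tail

variable {F : ℝ → ℂ} {a : ℝ}

theorem integral_Ioi_eq_sub (hF : IntegrableOn F (Ioi a)) {t : ℝ} (ht : a ≤ t) :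
    ∫ s in Ioi t, F s = (∫ s in Ioi a, F s) - ∫ s in a..t, F s := by
  rw [eq_sub_iff_add_eq, add_comm]
  exact intervalIntegral.integral_interval_add_Ioi hF (hF.mono_set (Ioi_subset_Ioi ht))

theorem continuousOn_integral_Ioi (hF : IntegrableOn F (Ioi a)) :
    ContinuousOn (fun t => ∫ s in Ioi t, F s) (Ici a) := by
  -- Cut off to the left of `a`, `F` is integrable on `ℝ` and its primitive is continuous
  -- everywhere.
  have h1 : Integrable ((Ioi a).indicator F) := hF.integrable_indicator measurableSet_Ioi
  have h2 : Continuous fun t => (∫ s in Ioi a, F s) - ∫ s in a..t, (Ioi a).indicator F s :=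
    continuous_const.sub (intervalIntegral.continuous_primitive
      (fun _ _ => h1.intervalIntegrable) a)
  refine h2.continuousOn.congr fun t ht => ?_
  simp only
  rw [integral_Ioi_eq_sub hF ht]
  congr 1
  refine intervalIntegral.integral_congr_ae (ae_of_all _ fun s hs => ?_)
  rw [uIoc_of_le ht] at hs
  rw [indicator_of_mem (show s ∈ Ioi a from hs.1)]

theorem hasDerivAt_integral_Ioi (hF : IntegrableOn F (Ioi a)) (hc : ContinuousOn F (Ici a))
    {t : ℝ} (ht : a < t) : HasDerivAt (fun t => ∫ s in Ioi t, F s) (-F t) t := by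
  have hct : ContinuousAt F t := (hc t ht.le).continuousAt (Ici_mem_nhds ht)
  have hi : IntervalIntegrable F volume a t := by
    rw [intervalIntegrable_iff_integrableOn_Ioc_of_le ht.le]
    exact hF.mono_set fun s hs => hs.1
  have h2 : HasDerivAt (fun t => (∫ s in Ioi a, F s) - ∫ s in a..t, F s) (-F t) t := by
    have := intervalIntegral.integral_hasDerivAt_right hi
      (ContinuousOn.stronglyMeasurableAtFilter isOpen_Ioi
        (hc.mono Ioi_subset_Ici_self) t ht) hct
    simpa using this.const_sub (∫ s in Ioi a, F s)
  refine h2.congr_of_eventuallyEq ?_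
  filter_upwards [Ioi_mem_nhds ht] with s hs
  exact integral_Ioi_eq_sub hF (le_of_lt hs)

end Tail

/-- The weight `exp (c / √t)`. -/
noncomputable def expWeight (c t : ℝ) : ℝ := Real.exp (c * t ^ (-1 / 2 : ℝ))

theorem expWeight_pos (c t : ℝ) : 0 < expWeight c t := Real.exp_pos _

theorem expWeight_zero (t : ℝ) : expWeight 0 t = 1 := by simp [expWeight]

theorem expWeight_anti {c : ℝ} (hc : 0 ≤ c) {s t : ℝ} (hs : 0 < s) (hst : s ≤ t) :
    expWeight c t ≤ expWeight c s := by
  refine Real.exp_le_exp.2 (mul_le_mul_of_nonneg_left ?_ hc)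
  exact Real.rpow_le_rpow_of_nonpos hs hst (by norm_num)

theorem one_le_expWeight {c : ℝ} (hc : 0 ≤ c) {t : ℝ} (ht : 0 ≤ t) : 1 ≤ expWeight c t :=
  Real.one_le_exp (by positivity)

theorem expWeight_le {c : ℝ} (hc : 0 ≤ c) {t : ℝ} (ht : 1 ≤ t) :
    expWeight c t ≤ Real.exp c := by
  simpa [expWeight] using expWeight_anti hc one_pos ht

theorem continuousOn_expWeight (c : ℝ) : ContinuousOn (expWeight c) (Ioi 0) := by
  unfold expWeight
  refine Real.continuous_exp.comp_continuousOn (continuousOn_const.mul ?_)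
  exact continuousOn_id.rpow_const fun x hx => Or.inl (ne_of_gt hx)

theorem hasDerivAt_expWeight (c : ℝ) {t : ℝ} (ht : 0 < t) :
    HasDerivAt (fun s => -(2 / c) * expWeight c s)
      ((-(2 / c)) * (expWeight c t * (c * (-1 / 2 * t ^ (-3 / 2 : ℝ))))) t := by
  have h1 : HasDerivAt (fun s : ℝ => s ^ (-1 / 2 : ℝ)) (-1 / 2 * t ^ (-3 / 2 : ℝ)) t := by
    have := Real.hasDerivAt_rpow_const (x := t) (p := -1 / 2) (Or.inl ht.ne')
    norm_num at this ⊢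
    exact this
  exact ((h1.const_mul c).exp).const_mul _

theorem tendsto_expWeight (c : ℝ) : Tendsto (expWeight c) atTop (𝓝 1) := by
  have h1 : Tendsto (fun s : ℝ => s ^ (-1 / 2 : ℝ)) atTop (𝓝 0) := by
    have := tendsto_rpow_neg_atTop (y := 1 / 2) (by norm_num)
    norm_num at this ⊢
    exact this
  have := (h1.const_mul c).rexp
  rw [mul_zero, Real.exp_zero] at this
  exact this

theorem integrableOn_weight {c : ℝ} (hc : 0 ≤ c) {t : ℝ} (ht : 0 < t) :
    IntegrableOn (fun s : ℝ => expWeight c s * s ^ (-3 / 2 : ℝ)) (Ioi t) := by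
  have h1 := (integrableOn_Ioi_rpow_of_lt (a := -3 / 2) (by norm_num) ht).const_mul
    (expWeight c t)
  refine h1.mono' ?_ ?_
  · refine ContinuousOn.aestronglyMeasurable ?_ measurableSet_Ioi
    refine ((continuousOn_expWeight c).mono (Ioi_subset_Ioi ht.le)).mul ?_
    exact continuousOn_id.rpow_const fun x hx => Or.inl (ne_of_gt (ht.trans hx))
  · refine (ae_restrict_mem measurableSet_Ioi).mono fun s hs => ?_
    have hs0 : 0 < s := ht.trans hs
    have := expWeight_pos c s
    rw [Real.norm_of_nonneg (by positivity)]
    gcongr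
    exact expWeight_anti hc ht (le_of_lt hs)

/-- The integrand is the exact derivative of `-(2/c) expWeight c`. The gain `2/c` is what makes the
operator small in the weighted norm for large `c`. -/
theorem integral_weight_le {c : ℝ} (hc : 0 < c) {t : ℝ} (ht : 0 < t) :
    ∫ s in Ioi t, expWeight c s * s ^ (-3 / 2 : ℝ) ≤ 2 / c * expWeight c t := by
  have h1 : ∀ s ∈ Ici t, HasDerivAt (fun s => -(2 / c) * expWeight c s)
      (expWeight c s * s ^ (-3 / 2 : ℝ)) s := by
    intro s hs
    refine (hasDerivAt_expWeight c (ht.trans_le hs)).congr_deriv ?_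
    field_simp
  rw [integral_Ioi_of_hasDerivAt_of_tendsto' h1 (integrableOn_weight hc.le ht)
    ((tendsto_expWeight c).const_mul _)]
  have : 0 < 2 / c := by positivity
  linarith

/-- A weight `h` which grows in a controlled way, and a potential `W` of decay `t ^ (-5/2)`. -/
structure VolterraKernel (h W : ℝ → ℂ) (C A : ℝ) : Prop where
  continuousOn_weight : ContinuousOn h (Ici 1)
  weight_ne_zero : ∀ t, 1 ≤ t → h t ≠ 0
  weight_le : ∀ τ s, 1 ≤ τ → τ ≤ s → ‖h s‖ ^ 2 ≤ C * ‖h τ‖ ^ 2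
  continuousOn_potential : ContinuousOn W (Ici 1)
  potential_le : ∀ s, 1 ≤ s → ‖W s‖ ≤ A * s ^ (-5 / 2 : ℝ)
  C_pos : 0 < C
  A_pos : 0 < A

/-- `h(τ)⁻² ∫_τ^∞ h² W g`. -/
noncomputable def volterraTail (h W g : ℝ → ℂ) (τ : ℝ) : ℂ :=
  (∫ s in Ioi τ, h s ^ 2 * W s * g s) / h τ ^ 2

/-- `∫_t^∞ h(τ)⁻² ∫_τ^∞ h(s)² W(s) g(s) ds dτ`. -/
noncomputable def volterraOp (h W g : ℝ → ℂ) (t : ℝ) : ℂ :=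
  ∫ τ in Ioi t, volterraTail h W g τ

namespace VolterraKernel

variable {h W g g' : ℝ → ℂ} {C A c D : ℝ}

/-- Pulls `h` and the weight back from `s` to `τ`; the factor `‖h τ‖ ^ 2` then cancels against the
denominator of `volterraTail`. -/
theorem norm_integrand_le (K : VolterraKernel h W C A) (hc : 0 ≤ c)
    (hD : ∀ s, 1 ≤ s → ‖g s‖ ≤ D * expWeight c s) {τ s : ℝ} (hτ : 1 ≤ τ) (hs : τ ≤ s) :
    ‖h s ^ 2 * W s * g s‖ ≤ ‖h τ‖ ^ 2 * (C * A * D * expWeight c τ) * s ^ (-5 / 2 : ℝ) := by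
  have hC := K.C_pos
  have hA := K.A_pos
  have hD0 : 0 ≤ D := by
    have := (norm_nonneg _).trans (hD 1 le_rfl)
    exact nonneg_of_mul_nonneg_left this (expWeight_pos _ _)
  have hs0 : 0 < s := by linarith
  rw [norm_mul, norm_mul, norm_pow]
  calc ‖h s‖ ^ 2 * ‖W s‖ * ‖g s‖
      ≤ (C * ‖h τ‖ ^ 2) * (A * s ^ (-5 / 2 : ℝ)) * (D * expWeight c τ) := by
        gcongr
        · exact K.weight_le τ s hτ hs
        · exact K.potential_le s (hτ.trans hs)
        · refine (hD s (hτ.trans hs)).trans ?_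
          gcongr
          exact expWeight_anti hc (by linarith) hs
    _ = _ := by ring

theorem continuousOn_integrand (K : VolterraKernel h W C A) (hg : ContinuousOn g (Ici 1)) :
    ContinuousOn (fun s => h s ^ 2 * W s * g s) (Ici 1) :=
  ((K.continuousOn_weight.pow 2).mul K.continuousOn_potential).mul hg

theorem integrableOn_integrand (K : VolterraKernel h W C A) (hg : ContinuousOn g (Ici 1))
    (hc : 0 ≤ c) (hD : ∀ s, 1 ≤ s → ‖g s‖ ≤ D * expWeight c s) {τ : ℝ} (hτ : 1 ≤ τ) :
    IntegrableOn (fun s => h s ^ 2 * W s * g s) (Ioi τ) := by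
  have h1 := (integrableOn_Ioi_rpow_of_lt (a := -5 / 2) (by norm_num)
    (show 0 < τ by linarith)).const_mul (‖h τ‖ ^ 2 * (C * A * D * expWeight c τ))
  refine h1.mono' ?_ ?_
  · exact ((K.continuousOn_integrand hg).mono
      fun s hs => hτ.trans (le_of_lt hs)).aestronglyMeasurable measurableSet_Ioi
  · exact (ae_restrict_mem measurableSet_Ioi).mono fun s hs =>
      K.norm_integrand_le hc hD hτ (le_of_lt hs)

theorem norm_tail_le (K : VolterraKernel h W C A)
    (hc : 0 ≤ c) (hD : ∀ s, 1 ≤ s → ‖g s‖ ≤ D * expWeight c s) {τ : ℝ} (hτ : 1 ≤ τ) :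
    ‖volterraTail h W g τ‖ ≤ C * A * D * (2 / 3) * (expWeight c τ * τ ^ (-3 / 2 : ℝ)) := by
  have hτ0 : 0 < τ := by linarith
  have h1 := (integrableOn_Ioi_rpow_of_lt (a := -5 / 2) (by norm_num) hτ0).const_mul
    (‖h τ‖ ^ 2 * (C * A * D * expWeight c τ))
  have h2 : ‖∫ s in Ioi τ, h s ^ 2 * W s * g s‖ ≤
      ∫ s in Ioi τ, ‖h τ‖ ^ 2 * (C * A * D * expWeight c τ) * s ^ (-5 / 2 : ℝ) :=
    norm_integral_le_of_norm_le h1 ((ae_restrict_mem measurableSet_Ioi).mono fun s hs =>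
      K.norm_integrand_le hc hD hτ (le_of_lt hs))
  rw [integral_const_mul, integral_Ioi_rpow_of_lt (by norm_num) hτ0] at h2
  have h3 : 0 < ‖h τ‖ ^ 2 := by
    have := norm_pos_iff.2 (K.weight_ne_zero τ hτ)
    positivity
  rw [volterraTail, norm_div, norm_pow, div_le_iff₀ h3]
  refine h2.trans (le_of_eq ?_)
  norm_num
  ring

theorem continuousOn_tail (K : VolterraKernel h W C A) (hg : ContinuousOn g (Ici 1))
    (hc : 0 ≤ c) (hD : ∀ s, 1 ≤ s → ‖g s‖ ≤ D * expWeight c s) :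
    ContinuousOn (volterraTail h W g) (Ici 1) := by
  refine (continuousOn_integral_Ioi (K.integrableOn_integrand hg hc hD le_rfl)).div
    (K.continuousOn_weight.pow 2) fun t ht => pow_ne_zero 2 (K.weight_ne_zero t ht)

theorem integrableOn_tail (K : VolterraKernel h W C A) (hg : ContinuousOn g (Ici 1))
    (hc : 0 ≤ c) (hD : ∀ s, 1 ≤ s → ‖g s‖ ≤ D * expWeight c s) {t : ℝ} (ht : 1 ≤ t) :
    IntegrableOn (volterraTail h W g) (Ioi t) := by
  refine ((integrableOn_weight hc (show 0 < t by linarith)).const_mul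
    (C * A * D * (2 / 3))).mono' ?_ ?_
  · exact ((K.continuousOn_tail hg hc hD).mono
      fun s hs => ht.trans (le_of_lt hs)).aestronglyMeasurable measurableSet_Ioi
  · exact (ae_restrict_mem measurableSet_Ioi).mono fun s hs =>
      K.norm_tail_le hc hD (ht.trans (le_of_lt hs))

theorem norm_op_le (K : VolterraKernel h W C A)
    (hc : 0 < c) (hD : ∀ s, 1 ≤ s → ‖g s‖ ≤ D * expWeight c s) {t : ℝ} (ht : 1 ≤ t) :
    ‖volterraOp h W g t‖ ≤ C * A * D * (2 / 3) * (2 / c * expWeight c t) := by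
  have ht0 : 0 < t := by linarith
  have hD0 : 0 ≤ D := by
    have := (norm_nonneg _).trans (hD 1 le_rfl)
    exact nonneg_of_mul_nonneg_left this (expWeight_pos _ _)
  have hC := K.C_pos
  have hA := K.A_pos
  have h2 : ‖volterraOp h W g t‖ ≤
      ∫ s in Ioi t, C * A * D * (2 / 3) * (expWeight c s * s ^ (-3 / 2 : ℝ)) :=
    norm_integral_le_of_norm_le ((integrableOn_weight hc.le ht0).const_mul _)
      ((ae_restrict_mem measurableSet_Ioi).mono fun s hs =>
        K.norm_tail_le hc.le hD (ht.trans (le_of_lt hs)))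
  refine h2.trans ?_
  rw [integral_const_mul]
  gcongr
  exact integral_weight_le hc ht0

/-- The exponent `c = 8/3 * (C * A)` is chosen so that `C * A * (2/3) * (2/c) = 1/2`. -/
theorem norm_op_le_half (K : VolterraKernel h W C A)
    (hD : ∀ s, 1 ≤ s → ‖g s‖ ≤ D * expWeight (8 / 3 * (C * A)) s) {t : ℝ} (ht : 1 ≤ t) :
    ‖volterraOp h W g t‖ ≤ D / 2 * expWeight (8 / 3 * (C * A)) t := by
  have hC := K.C_pos
  have hA := K.A_pos
  refine (K.norm_op_le (by positivity) hD ht).trans (le_of_eq ?_)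
  field_simp
  norm_num

theorem continuousOn_op (K : VolterraKernel h W C A) (hg : ContinuousOn g (Ici 1))
    (hc : 0 ≤ c) (hD : ∀ s, 1 ≤ s → ‖g s‖ ≤ D * expWeight c s) :
    ContinuousOn (volterraOp h W g) (Ici 1) :=
  continuousOn_integral_Ioi (K.integrableOn_tail hg hc hD le_rfl)

theorem tail_sub (K : VolterraKernel h W C A) {D' : ℝ} (hg : ContinuousOn g (Ici 1))
    (hg' : ContinuousOn g' (Ici 1))
    (hc : 0 ≤ c) (hD : ∀ s, 1 ≤ s → ‖g s‖ ≤ D * expWeight c s)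
    (hD' : ∀ s, 1 ≤ s → ‖g' s‖ ≤ D' * expWeight c s) {t : ℝ} (ht : 1 ≤ t) :
    volterraTail h W (fun s => g s - g' s) t = volterraTail h W g t - volterraTail h W g' t := by
  rw [volterraTail, volterraTail, volterraTail, ← sub_div,
    ← integral_sub (K.integrableOn_integrand hg hc hD ht) (K.integrableOn_integrand hg' hc hD' ht)]
  simp only [mul_sub]

theorem op_sub (K : VolterraKernel h W C A) {D' : ℝ} (hg : ContinuousOn g (Ici 1))
    (hg' : ContinuousOn g' (Ici 1))
    (hc : 0 ≤ c) (hD : ∀ s, 1 ≤ s → ‖g s‖ ≤ D * expWeight c s)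
    (hD' : ∀ s, 1 ≤ s → ‖g' s‖ ≤ D' * expWeight c s) {t : ℝ} (ht : 1 ≤ t) :
    volterraOp h W (fun s => g s - g' s) t = volterraOp h W g t - volterraOp h W g' t := by
  rw [volterraOp, volterraOp, volterraOp,
    ← integral_sub (K.integrableOn_tail hg hc hD ht) (K.integrableOn_tail hg' hc hD' ht)]
  refine setIntegral_congr_fun measurableSet_Ioi fun s hs => ?_
  exact K.tail_sub hg hg' hc hD hD' (ht.trans (le_of_lt hs))

/-- A priori estimate for the Volterra equation. -/
theorem norm_le_of_norm_le_add_op (K : VolterraKernel h W C A) {ε B : ℝ} (hε : 0 ≤ ε)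
    (hB : ∀ t, 1 ≤ t → ‖g t‖ ≤ B)
    (hg : ∀ t, 1 ≤ t → ‖g t‖ ≤ ε + ‖volterraOp h W g t‖) {t : ℝ} (ht : 1 ≤ t) :
    ‖g t‖ ≤ 2 * ε * Real.exp (8 / 3 * (C * A)) := by
  have hC := K.C_pos
  have hA := K.A_pos
  set c := 8 / 3 * (C * A) with hc
  have hc0 : 0 < c := by positivity
  have hB0 : 0 ≤ B := (norm_nonneg _).trans (hB t ht)
  -- One application of the operator turns a bound `D` into `ε + D/2`, whose fixed point is `2ε`.
  -- The a priori bound `B` is halved each time and drops out in the limit.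
  have key : ∀ n : ℕ, ∀ t, 1 ≤ t → ‖g t‖ ≤ (2 * ε + B / 2 ^ n) * expWeight c t := by
    intro n
    induction n with
    | zero =>
      intro t ht
      have h1 := one_le_expWeight hc0.le (show 0 ≤ t by linarith)
      have h2 := hB t ht
      refine le_trans ?_ (le_mul_of_one_le_right (by positivity) h1)
      simp only [pow_zero, div_one]
      linarith
    | succ n ih =>
      intro t ht
      have h1 := one_le_expWeight hc0.le (show 0 ≤ t by linarith)
      have h2 := K.norm_op_le_half ih ht
      rw [← hc] at h2
      have h4 : ε ≤ ε * expWeight c t := le_mul_of_one_le_right hε h1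
      refine (hg t ht).trans ((add_le_add h4 h2).trans (le_of_eq ?_))
      rw [pow_succ]
      field_simp
      ring
  have h1 : Tendsto (fun n : ℕ => (2 * ε + B / 2 ^ n) * expWeight c t) atTop
      (𝓝 ((2 * ε + 0) * expWeight c t)) := by
    refine (tendsto_const_nhds.add ?_).mul_const _
    exact tendsto_const_nhds.div_atTop (tendsto_pow_atTop_atTop_of_one_lt one_lt_two)
  have h2 := ge_of_tendsto' h1 fun n => key n t ht
  rw [add_zero] at h2
  refine h2.trans ?_
  gcongr
  exact expWeight_le hc0.le ht

/-- The Volterra equation has a bounded solution. -/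
theorem exists_solution (K : VolterraKernel h W C A) :
    ∃ g : ℝ → ℂ, ContinuousOn g (Ici 1) ∧ (∀ t, 1 ≤ t → g t = 1 + volterraOp h W g t) ∧
      ∀ t, 1 ≤ t → ‖g t‖ ≤ 2 * Real.exp (8 / 3 * (C * A)) := by
  have hC := K.C_pos
  have hA := K.A_pos
  set c := 8 / 3 * (C * A) with hc
  have hc0 : 0 < c := by positivity
  have hpc : ContinuousOn (fun s => (expWeight c s : ℂ)) (Ici 1) :=
    Complex.continuous_ofReal.comp_continuousOn
      ((continuousOn_expWeight c).mono fun s hs => mem_Ioi.2 (zero_lt_one.trans_le (mem_Ici.1 hs)))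
  have hgc : ∀ f : BoundedContinuousFunction ℝ ℂ,
      ContinuousOn (fun s => (expWeight c s : ℂ) * f s) (Ici 1) := fun f =>
    hpc.mul f.continuous.continuousOn
  have hwn : ∀ s, ‖(expWeight c s : ℂ)‖ = expWeight c s := fun s => by
    rw [Complex.norm_real, Real.norm_of_nonneg (expWeight_pos c s).le]
  have hgD : ∀ f : BoundedContinuousFunction ℝ ℂ, ∀ s, 1 ≤ s →
      ‖(expWeight c s : ℂ) * f s‖ ≤ ‖f‖ * expWeight c s := fun f s _ => by
    rw [norm_mul, hwn, mul_comm]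
    gcongr
    · exact (expWeight_pos c s).le
    · exact f.norm_coe_le_norm s
  -- The unknown is `f = g / expWeight c`, so its sup norm is the weighted norm of `g`. `max t 1`
  -- freezes the right-hand side left of `1`, so the contraction acts on bounded continuous
  -- functions on all of `ℝ`.
  have hTc : ∀ f : BoundedContinuousFunction ℝ ℂ, Continuous fun t : ℝ =>
      (expWeight c (max t 1) : ℂ)⁻¹ *
        (1 + volterraOp h W (fun s => (expWeight c s : ℂ) * f s) (max t 1)) := by
    intro f
    have h1 : ContinuousOn (fun t : ℝ => (expWeight c t : ℂ)⁻¹ *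
        (1 + volterraOp h W (fun s => (expWeight c s : ℂ) * f s) t)) (Ici 1) := by
      refine (hpc.inv₀ fun s _ => ?_).mul
        (continuousOn_const.add (K.continuousOn_op (hgc f) hc0.le (hgD f)))
      exact_mod_cast (expWeight_pos c s).ne'
    exact h1.comp_continuous (by fun_prop) fun t => le_max_right t 1
  have hinv : ∀ t x D, ‖x‖ ≤ D * expWeight c t → ‖(expWeight c t : ℂ)⁻¹ * x‖ ≤ D := by
    intro t x D hx
    rw [norm_mul, norm_inv, hwn, inv_mul_le_iff₀ (expWeight_pos c t), mul_comm]
    exact hx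
  let T : BoundedContinuousFunction ℝ ℂ → BoundedContinuousFunction ℝ ℂ := fun f =>
    BoundedContinuousFunction.ofNormedAddCommGroup _ (hTc f) (1 + ‖f‖ / 2) fun t => by
      refine hinv _ _ _ ((norm_add_le _ _).trans ?_)
      rw [add_mul]
      refine add_le_add ?_ (K.norm_op_le_half (hgD f) (le_max_right t 1))
      simpa using one_le_expWeight hc0.le (zero_le_one.trans (le_max_right t 1))
  have hTapp : ∀ f t, T f t = (expWeight c (max t 1) : ℂ)⁻¹ *
        (1 + volterraOp h W (fun s => (expWeight c s : ℂ) * f s) (max t 1)) := fun _ _ => rfl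
  have hT : ContractingWith (1 / 2) T := by
    refine ⟨by rw [← NNReal.coe_lt_coe]; norm_num, LipschitzWith.of_dist_le_mul fun f f' => ?_⟩
    rw [dist_eq_norm, dist_eq_norm, BoundedContinuousFunction.norm_le (by positivity)]
    intro t
    rw [BoundedContinuousFunction.sub_apply, hTapp, hTapp, ← mul_sub, add_sub_add_left_eq_sub,
      ← K.op_sub (hgc f) (hgc f') hc0.le (hgD f) (hgD f') (le_max_right t 1)]
    refine hinv _ _ _ ?_
    have := K.norm_op_le_half (g := fun s => (expWeight c s : ℂ) * f s - expWeight c s * f' s)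
      (D := ‖f - f'‖) (fun s hs => by
        rw [← mul_sub]
        exact hgD (f - f') s hs) (le_max_right t 1)
    refine this.trans (le_of_eq ?_)
    simp
    ring
  have hfix := hT.fixedPoint_isFixedPt
  set f := hT.fixedPoint T with hf
  have heq : ∀ t, 1 ≤ t → (expWeight c t : ℂ) * f t =
      1 + volterraOp h W (fun s => (expWeight c s : ℂ) * f s) t := by
    intro t ht
    have h1 : f t = T f t := by rw [hfix]
    have h2 : (expWeight c t : ℂ) ≠ 0 := by exact_mod_cast (expWeight_pos c t).ne'
    rw [hTapp, max_eq_left ht] at h1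
    conv_lhs => rw [h1]
    rw [mul_inv_cancel_left₀ h2]
  refine ⟨fun s => (expWeight c s : ℂ) * f s, hgc f, heq, fun t ht => ?_⟩
  -- The a priori estimate with `ε = 1` replaces the bound through `‖f‖` by one depending on `C * A`
  -- only.
  have := K.norm_le_of_norm_le_add_op (g := fun s => (expWeight c s : ℂ) * f s)
    zero_le_one (B := ‖f‖ * Real.exp c)
    (fun t ht => (hgD f t ht).trans (by gcongr; exact expWeight_le hc0.le ht))
    (fun t ht => by
      rw [heq t ht]
      exact (norm_add_le _ _).trans (by simp)) ht
  simpa using this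

end VolterraKernel
end Schwarzschild

/-! ### Volterra solutions: asymptotics, derivatives and dependence on the kernel -/

namespace Schwarzschild

open MeasureTheory Set

namespace VolterraKernel

variable {h W g : ℝ → ℂ} {C A B : ℝ}

/-- At `c = 0` the weight is `1`, so the weighted estimates apply to plain sup bounds. -/
theorem le_mul_expWeight_zero (hB : ∀ s, 1 ≤ s → ‖g s‖ ≤ B) (s : ℝ) (hs : 1 ≤ s) :
    ‖g s‖ ≤ B * expWeight 0 s := by
  rw [expWeight_zero, mul_one]
  exact hB s hs

theorem tendsto_tail_atTop (K : VolterraKernel h W C A) (hB : ∀ s, 1 ≤ s → ‖g s‖ ≤ B) :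
    Tendsto (volterraTail h W g) atTop (𝓝 0) := by
  have h1 : Tendsto (fun s : ℝ => s ^ (-3 / 2 : ℝ)) atTop (𝓝 0) := by
    have := tendsto_rpow_neg_atTop (y := 3 / 2) (by norm_num)
    norm_num at this ⊢
    exact this
  have h2 := h1.const_mul (C * A * B * (2 / 3))
  rw [mul_zero] at h2
  refine squeeze_zero_norm' ?_ h2
  filter_upwards [eventually_ge_atTop 1] with t ht
  have := K.norm_tail_le le_rfl (le_mul_expWeight_zero hB) ht
  rwa [expWeight_zero, one_mul] at this

theorem tendsto_solution_atTop (heq : ∀ t, 1 ≤ t → g t = 1 + volterraOp h W g t) :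
    Tendsto g atTop (𝓝 1) := by
  have h1 : Tendsto (volterraOp h W g) atTop (𝓝 0) :=
    tendsto_integral_Ioi_zero (f := volterraTail h W g) (b := id) tendsto_id
  have h2 := h1.const_add 1
  rw [add_zero] at h2
  refine h2.congr' ?_
  filter_upwards [eventually_ge_atTop 1] with t ht
  exact (heq t ht).symm

theorem hasDerivAt_solution (K : VolterraKernel h W C A) (hg : ContinuousOn g (Ici 1))
    (hB : ∀ s, 1 ≤ s → ‖g s‖ ≤ B) (heq : ∀ t, 1 ≤ t → g t = 1 + volterraOp h W g t)
    {t : ℝ} (ht : 1 < t) : HasDerivAt g (-volterraTail h W g t) t := by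
  have h1 := (hasDerivAt_integral_Ioi
    (K.integrableOn_tail hg le_rfl (le_mul_expWeight_zero hB) le_rfl)
    (K.continuousOn_tail hg le_rfl (le_mul_expWeight_zero hB)) ht).const_add 1
  refine h1.congr_of_eventuallyEq ?_
  filter_upwards [Ioi_mem_nhds ht] with s hs
  exact heq s (le_of_lt hs)

/-- Variation of constants: if `h'' = q h` and `g` solves the Volterra equation, then `h g` solves
`φ'' = (q + W) φ`. -/
theorem hasDerivAt_mul_solution (K : VolterraKernel h W C A) (hg : ContinuousOn g (Ici 1))
    (hB : ∀ s, 1 ≤ s → ‖g s‖ ≤ B) (heq : ∀ t, 1 ≤ t → g t = 1 + volterraOp h W g t)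
    {h' : ℝ → ℂ} {q : ℂ} {t : ℝ} (ht : 1 < t) (hh : HasDerivAt h (h' t) t)
    (hh' : HasDerivAt h' (q * h t) t) :
    HasDerivAt (fun s => h s * g s) (h' t * g t - h t * volterraTail h W g t) t ∧
    HasDerivAt (fun s => h' s * g s - h s * volterraTail h W g s)
      ((q + W t) * (h t * g t)) t := by
  have hg' := K.hasDerivAt_solution hg hB heq ht
  refine ⟨(hh.mul hg').congr_deriv (by ring), ?_⟩
  have hN := hasDerivAt_integral_Ioi
    (K.integrableOn_integrand hg le_rfl (le_mul_expWeight_zero hB) le_rfl)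
    (K.continuousOn_integrand hg) ht
  have hne := K.weight_ne_zero t ht.le
  have hT : HasDerivAt (volterraTail h W g) _ t := hN.div (hh.pow 2) (pow_ne_zero 2 hne)
  refine ((hh'.mul hg').sub (hh.mul hT)).congr_deriv ?_
  rw [volterraTail]
  simp
  field_simp
  ring

section Convergence

variable {ι : Type*} {𝓕 : Filter ι} [𝓕.IsCountablyGenerated] {H G : ι → ℝ → ℂ}

/-- Dominated convergence with constants uniform in `i`; the majorant involves `‖H i t‖ ^ 2`, which
is eventually below `‖h t‖ ^ 2 + 1`. -/
theorem tendsto_tail (K : VolterraKernel h W C A)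
    (hK : ∀ᶠ i in 𝓕, VolterraKernel (H i) W C A)
    (hH : ∀ t, 1 ≤ t → Tendsto (fun i => H i t) 𝓕 (𝓝 (h t)))
    (hG : ∀ᶠ i in 𝓕, ContinuousOn (G i) (Ici 1) ∧ ∀ s, 1 ≤ s → ‖G i s‖ ≤ B)
    (hGg : ∀ t, 1 ≤ t → Tendsto (fun i => G i t) 𝓕 (𝓝 (g t))) {t : ℝ} (ht : 1 ≤ t) :
    Tendsto (fun i => volterraTail (H i) W (G i) t) 𝓕 (𝓝 (volterraTail h W g t)) := by
  have hC := K.C_pos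
  have hA := K.A_pos
  refine Tendsto.div ?_ ((hH t ht).pow 2) (pow_ne_zero 2 (K.weight_ne_zero t ht))
  refine tendsto_integral_filter_of_dominated_convergence
    (fun s => (‖h t‖ ^ 2 + 1) * (C * A * B) * s ^ (-5 / 2 : ℝ)) ?_ ?_ ?_ ?_
  · filter_upwards [hK, hG] with i hi hi'
    exact ((hi.continuousOn_integrand hi'.1).mono
      fun s hs => ht.trans (le_of_lt hs)).aestronglyMeasurable measurableSet_Ioi
  · have h1 : ∀ᶠ i in 𝓕, ‖H i t‖ ^ 2 < ‖h t‖ ^ 2 + 1 :=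
      ((hH t ht).norm.pow 2).eventually (gt_mem_nhds (lt_add_one _))
    filter_upwards [hK, hG, h1] with i hi hi' hi1
    have hB0 : 0 ≤ B := (norm_nonneg _).trans (hi'.2 1 le_rfl)
    refine (ae_restrict_mem measurableSet_Ioi).mono fun s hs => ?_
    have hs0 : 0 < s := by linarith [mem_Ioi.1 hs]
    have := hi.norm_integrand_le le_rfl (le_mul_expWeight_zero hi'.2) ht (le_of_lt hs)
    rw [expWeight_zero, mul_one] at this
    refine this.trans ?_
    gcongr
  · exact (integrableOn_Ioi_rpow_of_lt (by norm_num) (by linarith)).const_mul _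
  · refine (ae_restrict_mem measurableSet_Ioi).mono fun s hs => ?_
    have hs1 : 1 ≤ s := by linarith [mem_Ioi.1 hs]
    exact (((hH s hs1).pow 2).mul_const _).mul (hGg s hs1)

/-- With `T_i`, `T` the Volterra operators, `G_i - g = (T_i g - T g) + T_i (G_i - g)`. The first
term is at most the integral over `(1, ∞)` of the difference of the tails, which tends to `0`; the a
priori estimate absorbs the second. -/
theorem tendsto_solution (K : VolterraKernel h W C A)
    (hK : ∀ᶠ i in 𝓕, VolterraKernel (H i) W C A)
    (hH : ∀ t, 1 ≤ t → Tendsto (fun i => H i t) 𝓕 (𝓝 (h t)))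
    (hG : ∀ᶠ i in 𝓕, ContinuousOn (G i) (Ici 1) ∧ ∀ s, 1 ≤ s → ‖G i s‖ ≤ B)
    (hGeq : ∀ᶠ i in 𝓕, ∀ t, 1 ≤ t → G i t = 1 + volterraOp (H i) W (G i) t)
    (hg : ContinuousOn g (Ici 1)) (hB : ∀ s, 1 ≤ s → ‖g s‖ ≤ B)
    (heq : ∀ t, 1 ≤ t → g t = 1 + volterraOp h W g t) {t : ℝ} (ht : 1 ≤ t) :
    Tendsto (fun i => G i t) 𝓕 (𝓝 (g t)) := by
  have hC := K.C_pos
  have hA := K.A_pos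
  have hB' := le_mul_expWeight_zero hB
  have hconst : ∀ᶠ i in 𝓕, ContinuousOn g (Ici 1) ∧ ∀ s, 1 ≤ s → ‖g s‖ ≤ B :=
    Eventually.of_forall fun _ => ⟨hg, hB⟩
  have hε : Tendsto (fun i => ∫ τ in Ioi 1, ‖volterraTail (H i) W g τ - volterraTail h W g τ‖)
      𝓕 (𝓝 (∫ τ in Ioi (1 : ℝ), (0 : ℝ))) := by
    refine tendsto_integral_filter_of_dominated_convergence
      (fun τ => 2 * (C * A * B * (2 / 3)) * τ ^ (-3 / 2 : ℝ)) ?_ ?_ ?_ ?_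
    · filter_upwards [hK] with i hi
      exact (((hi.continuousOn_tail hg le_rfl hB').sub
        (K.continuousOn_tail hg le_rfl hB')).norm.mono
        fun s hs => le_of_lt hs).aestronglyMeasurable measurableSet_Ioi
    · filter_upwards [hK] with i hi
      refine (ae_restrict_mem measurableSet_Ioi).mono fun s hs => ?_
      have h1 := hi.norm_tail_le le_rfl hB' (le_of_lt hs)
      have h2 := K.norm_tail_le le_rfl hB' (le_of_lt hs)
      rw [expWeight_zero, one_mul] at h1 h2
      rw [norm_norm]
      refine (norm_sub_le _ _).trans ((add_le_add h1 h2).trans (le_of_eq (by ring)))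
    · exact (integrableOn_Ioi_rpow_of_lt (by norm_num) one_pos).const_mul _
    · refine (ae_restrict_mem measurableSet_Ioi).mono fun s hs => ?_
      have := tendsto_tail K hK hH hconst (fun t _ => tendsto_const_nhds) (le_of_lt hs)
      have h2 := (this.sub_const (volterraTail h W g s)).norm
      rwa [sub_self, norm_zero] at h2
  rw [integral_zero] at hε
  have hε' := (hε.const_mul 2).mul_const (Real.exp (8 / 3 * (C * A)))
  rw [mul_zero, zero_mul] at hε'
  rw [tendsto_iff_norm_sub_tendsto_zero]
  refine squeeze_zero' (Eventually.of_forall fun _ => norm_nonneg _) ?_ hε'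
  filter_upwards [hK, hG, hGeq] with i hi hi1 hi2
  have hi1' := le_mul_expWeight_zero hi1.2
  refine hi.norm_le_of_norm_le_add_op (g := fun s => G i s - g s) (B := B + B)
    (integral_nonneg fun _ => norm_nonneg _)
    (fun s hs => (norm_sub_le _ _).trans (add_le_add (hi1.2 s hs) (hB s hs))) (fun s hs => ?_) ht
  have h1 : G i s - g s = (volterraOp (H i) W g s - volterraOp h W g s) +
      volterraOp (H i) W (fun s => G i s - g s) s := by
    rw [hi.op_sub hi1.1 hg le_rfl hi1' hB' hs, hi2 s hs, heq s hs]
    ring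
  rw [h1]
  refine (norm_add_le _ _).trans (add_le_add_left ?_ _)
  rw [volterraOp, volterraOp, ← integral_sub (hi.integrableOn_tail hg le_rfl hB' hs)
    (K.integrableOn_tail hg le_rfl hB' hs)]
  refine (norm_integral_le_integral_norm _).trans ?_
  refine setIntegral_mono_set ?_ (ae_of_all _ fun _ => norm_nonneg _)
    (Ioi_subset_Ioi hs).eventuallyLE
  exact ((hi.integrableOn_tail hg le_rfl hB' le_rfl).sub
    (K.integrableOn_tail hg le_rfl hB' le_rfl)).norm

end Convergence

end VolterraKernel
end Schwarzschild

/-! ### The explicit solutions for the centrifugal potential -/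

namespace Schwarzschild

open Set

/-- The solution `e^{-iωt} θ_l(iωt) / t^l` of `φ'' = (-ω² + l(l+1)/t²) φ`. -/
noncomputable def freeSol (l : ℕ) (ω : ℂ) (t : ℝ) : ℂ :=
  Complex.exp (-(Complex.I * ω * t)) * (besselTheta l).eval (Complex.I * ω * t) *
    (t : ℂ) ^ (-(l : ℤ))

/-- The derivative of `freeSol`. -/
noncomputable def freeSolDeriv (l : ℕ) (ω : ℂ) (t : ℝ) : ℂ :=
  Complex.exp (-(Complex.I * ω * t)) * (Complex.I * ω *
    ((besselTheta l).derivative.eval (Complex.I * ω * t) -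
      (besselTheta l).eval (Complex.I * ω * t)) -
    l * (besselTheta l).eval (Complex.I * ω * t) * (t : ℂ)⁻¹) * (t : ℂ) ^ (-(l : ℤ))

section Derivatives

variable (l : ℕ) (ω : ℂ) (t : ℝ)

theorem hasDerivAt_mul_ofReal (a : ℂ) : HasDerivAt (fun t : ℝ => a * (t : ℂ)) a t := by
  simpa using (Complex.ofRealCLM.hasDerivAt (x := t)).const_mul a

theorem hasDerivAt_cexp_mul_ofReal (a : ℂ) :
    HasDerivAt (fun t : ℝ => Complex.exp (a * t)) (a * Complex.exp (a * t)) t := by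
  simpa [mul_comm] using (hasDerivAt_mul_ofReal t a).cexp

theorem hasDerivAt_cexp_neg_mul_ofReal (a : ℂ) :
    HasDerivAt (fun t : ℝ => Complex.exp (-(a * t))) (-a * Complex.exp (-(a * t))) t := by
  simpa using hasDerivAt_cexp_mul_ofReal t (-a)

theorem hasDerivAt_eval_mul_ofReal (p : Polynomial ℂ) (a : ℂ) :
    HasDerivAt (fun t : ℝ => p.eval (a * t)) (a * p.derivative.eval (a * t)) t := by
  have := (p.hasDerivAt (a * (t : ℂ))).comp t (hasDerivAt_mul_ofReal t a)
  rwa [mul_comm] at this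

variable {t}

theorem hasDerivAt_ofReal_zpow (m : ℤ) (ht : t ≠ 0) :
    HasDerivAt (fun t : ℝ => (t : ℂ) ^ m) (m * ((t : ℂ) ^ m * (t : ℂ)⁻¹)) t := by
  have ht' : (t : ℂ) ≠ 0 := by exact_mod_cast ht
  have := (hasDerivAt_zpow m (t : ℂ) (Or.inl ht')).comp_ofReal
  rwa [zpow_sub_one₀ ht'] at this

theorem hasDerivAt_freeSol (ht : t ≠ 0) :
    HasDerivAt (freeSol l ω) (freeSolDeriv l ω t) t := by
  refine (((hasDerivAt_cexp_neg_mul_ofReal t (Complex.I * ω)).mul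
    (hasDerivAt_eval_mul_ofReal t (besselTheta l) (Complex.I * ω))).mul
      (hasDerivAt_ofReal_zpow (-(l : ℤ)) ht)).congr_deriv ?_
  rw [freeSolDeriv]
  simp only [Pi.mul_apply]
  push_cast
  ring

theorem hasDerivAt_freeSolDeriv (ht : t ≠ 0) :
    HasDerivAt (freeSolDeriv l ω)
      ((-ω ^ 2 + (l : ℂ) * (l + 1) / (t : ℂ) ^ 2) * freeSol l ω t) t := by
  have ht' : (t : ℂ) ≠ 0 := by exact_mod_cast ht
  have h1 := hasDerivAt_eval_mul_ofReal t (besselTheta l) (Complex.I * ω)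
  have h2 := hasDerivAt_eval_mul_ofReal t (besselTheta l).derivative (Complex.I * ω)
  have h3 := hasDerivAt_ofReal_zpow (-1) ht
  simp only [zpow_neg_one] at h3
  have h4 := ((h2.sub h1).const_mul (Complex.I * ω)).sub ((h1.const_mul (l : ℂ)).mul h3)
  refine (((hasDerivAt_cexp_neg_mul_ofReal t (Complex.I * ω)).mul h4).mul
      (hasDerivAt_ofReal_zpow (-(l : ℤ)) ht)).congr_deriv ?_
  have hode := congrArg (Polynomial.eval (Complex.I * ω * t)) (besselTheta_ode l)
  simp only [Polynomial.eval_mul, Polynomial.eval_sub, Polynomial.eval_add, Polynomial.eval_X,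
    Polynomial.eval_C] at hode
  rw [freeSol]
  simp only [Pi.mul_apply, Pi.sub_apply]
  -- Writing `-ω² = (iω)²`, the claim is algebra in `a = iω`, with the Bessel equation `hode` as
  -- only analytic input.
  generalize (besselTheta l).eval (Complex.I * ω * t) = x at *
  generalize (besselTheta l).derivative.eval (Complex.I * ω * t) = x' at *
  generalize (besselTheta l).derivative.derivative.eval (Complex.I * ω * t) = x'' at *
  generalize Complex.exp (-(Complex.I * ω * t)) = e at *
  generalize (t : ℂ) ^ (-(l : ℤ)) = m at *
  generalize (t : ℂ) = r at *
  push_cast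
  have hI : -ω ^ 2 = (Complex.I * ω) ^ 2 := by rw [mul_pow, Complex.I_sq]; ring
  rw [hI]
  generalize Complex.I * ω = a at *
  have : x'' * a * r = 2 * (a * r + l) * x' - 2 * l * x := by linear_combination hode
  field_simp
  linear_combination (e * m * a * r) * this

end Derivatives

theorem freeSol_ne_zero (l : ℕ) {ω : ℂ} (hω : ω.im ≤ 0) {t : ℝ} (ht : 0 < t) :
    freeSol l ω t ≠ 0 := by
  have ht' : (t : ℂ) ≠ 0 := by exact_mod_cast ht.ne'
  refine mul_ne_zero (mul_ne_zero (Complex.exp_ne_zero _) (eval_besselTheta_ne_zero l ?_))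
    (zpow_ne_zero _ ht')
  simp
  nlinarith

/-- Uniform control of the growth of the free solution, for all `ω` in the closed lower half
plane. -/
theorem exists_norm_freeSol_le (l : ℕ) : ∃ K : ℝ, 1 ≤ K ∧ ∀ ω : ℂ, ω.im ≤ 0 →
    ∀ τ s : ℝ, 0 < τ → τ ≤ s → ‖freeSol l ω s‖ ≤ K * ‖freeSol l ω τ‖ := by
  obtain ⟨K, hK1, hK⟩ := exists_norm_eval_smul_le (besselTheta l)
    fun z hz => eval_besselTheta_ne_zero l hz
  refine ⟨K, hK1, fun ω hω τ s hτ hs => ?_⟩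
  have hs0 : 0 < s := hτ.trans_le hs
  have hre : ∀ t : ℝ, (Complex.I * ω * t).re = -ω.im * t := by simp
  have hr : 1 ≤ s / τ := (one_le_div hτ).2 hs
  -- Since `Re(iω) ≥ 0`, the exponential does not grow. The polynomial grows by at most `K (s/τ)^l`,
  -- which the factor `t^{-l}` cancels.
  have h1 := hK (Complex.I * ω * τ) (by rw [hre]; exact mul_nonneg (neg_nonneg.2 hω) hτ.le)
    (s / τ) hr
  have h2 : ((s / τ : ℝ) : ℂ) * (Complex.I * ω * τ) = Complex.I * ω * s := by
    have : (τ : ℂ) ≠ 0 := by exact_mod_cast hτ.ne'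
    push_cast
    field_simp
  rw [h2] at h1
  have h3 : ‖Complex.exp (-(Complex.I * ω * s))‖ ≤ ‖Complex.exp (-(Complex.I * ω * τ))‖ := by
    rw [Complex.norm_exp, Complex.norm_exp, Real.exp_le_exp, Complex.neg_re, Complex.neg_re,
      hre, hre]
    nlinarith
  have h4 : (s / τ) ^ (besselTheta l).natDegree ≤ (s / τ) ^ l :=
    pow_le_pow_right₀ hr (natDegree_besselTheta_le l)
  have hn : ∀ t : ℝ, 0 < t → ‖(t : ℂ) ^ (-(l : ℤ))‖ = (t ^ l)⁻¹ := fun t ht => by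
    rw [norm_zpow, Complex.norm_real, Real.norm_of_nonneg ht.le, zpow_neg, zpow_natCast]
  rw [freeSol, freeSol, norm_mul, norm_mul, norm_mul, norm_mul, hn s hs0, hn τ hτ]
  calc _ ≤ ‖Complex.exp (-(Complex.I * ω * τ))‖ *
        (K * (s / τ) ^ l * ‖(besselTheta l).eval (Complex.I * ω * τ)‖) * (s ^ l)⁻¹ := by
        gcongr
        refine h1.trans ?_
        gcongr
    _ = _ := by
        rw [div_pow]
        field_simp

theorem volterraKernel_freeSol {l : ℕ} {K : ℝ} (hK1 : 1 ≤ K) (hK : ∀ ω : ℂ, ω.im ≤ 0 →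
    ∀ τ s : ℝ, 0 < τ → τ ≤ s → ‖freeSol l ω s‖ ≤ K * ‖freeSol l ω τ‖)
    {W : ℝ → ℂ} {A : ℝ} (hW : ContinuousOn W (Ici 1)) (hA : 0 < A)
    (hWA : ∀ s, 1 ≤ s → ‖W s‖ ≤ A * s ^ (-5 / 2 : ℝ)) {ω : ℂ} (hω : ω.im ≤ 0) :
    VolterraKernel (freeSol l ω) W (K ^ 2) A where
  continuousOn_weight t ht :=
    (hasDerivAt_freeSol l ω (by linarith [mem_Ici.1 ht])).continuousAt.continuousWithinAt
  weight_ne_zero t ht := freeSol_ne_zero l hω (by linarith)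
  weight_le τ s hτ hs := by
    rw [← mul_pow]
    gcongr
    exact hK ω hω τ s (by linarith) hs
  continuousOn_potential := hW
  potential_le := hWA
  C_pos := by positivity
  A_pos := hA

theorem continuous_freeSol_param (l : ℕ) (t : ℝ) : Continuous fun ω => freeSol l ω t := by
  unfold freeSol
  fun_prop

theorem continuous_freeSolDeriv_param (l : ℕ) (t : ℝ) :
    Continuous fun ω => freeSolDeriv l ω t := by
  unfold freeSolDeriv
  fun_prop

theorem freeSol_zero (l : ℕ) (t : ℝ) :
    freeSol l 0 t = (Nat.doubleFactorial (2 * l - 1) : ℂ) * ((t : ℂ) ^ l)⁻¹ := by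
  simp [freeSol, eval_zero_besselTheta]

section Asymptotics

variable (l : ℕ) {ω : ℂ}

theorem exp_mul_freeSol (hω : ω ≠ 0) {t : ℝ} (ht : t ≠ 0) :
    Complex.exp (Complex.I * ω * t) * freeSol l ω t =
      (Complex.I * ω) ^ l * (besselY l).eval ((Complex.I * ω * t)⁻¹) := by
  have ht' : (t : ℂ) ≠ 0 := by exact_mod_cast ht
  rw [freeSol, eval_besselTheta_eq l (by simp [hω, ht]), Complex.exp_neg, zpow_neg, zpow_natCast,
    mul_pow _ (t : ℂ)]
  have := Complex.exp_ne_zero (Complex.I * ω * t)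
  field_simp

theorem tendsto_inv_mul_ofReal (a : ℂ) :
    Tendsto (fun t : ℝ => (a * (t : ℂ))⁻¹) atTop (𝓝 0) := by
  have h1 : Tendsto (fun t : ℝ => ((t⁻¹ : ℝ) : ℂ)) atTop (𝓝 0) := by
    have := (Complex.continuous_ofReal.tendsto 0).comp tendsto_inv_atTop_zero
    rwa [Complex.ofReal_zero] at this
  have h2 := h1.const_mul a⁻¹
  rw [mul_zero] at h2
  refine h2.congr fun t => ?_
  rw [mul_inv]
  push_cast
  rfl

theorem tendsto_exp_mul_freeSol (hω : ω ≠ 0) :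
    Tendsto (fun t : ℝ => Complex.exp (Complex.I * ω * t) * freeSol l ω t) atTop
      (𝓝 ((Complex.I * ω) ^ l)) := by
  have h1 := (((besselY l).continuous.tendsto 0).comp
    (tendsto_inv_mul_ofReal (Complex.I * ω))).const_mul ((Complex.I * ω) ^ l)
  rw [eval_zero_besselY, mul_one] at h1
  refine h1.congr' ?_
  filter_upwards [eventually_ne_atTop 0] with t ht
  exact (exp_mul_freeSol l hω ht).symm

/-- Both sides are the derivative of the two expressions in `exp_mul_freeSol`. The square of
`(iωt)⁻¹` shows the decay. -/
theorem exp_mul_freeSolDeriv (hω : ω ≠ 0) {t : ℝ} (ht : t ≠ 0) :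
    Complex.exp (Complex.I * ω * t) * (freeSolDeriv l ω t + Complex.I * ω * freeSol l ω t) =
      (Complex.I * ω) ^ l * ((besselY l).derivative.eval ((Complex.I * ω * t)⁻¹) *
        (-(Complex.I * ω) * ((Complex.I * ω * t)⁻¹) ^ 2)) := by
  have hz : Complex.I * ω * t ≠ 0 := by simp [hω, ht]
  have h1 := (hasDerivAt_cexp_mul_ofReal t (Complex.I * ω)).mul (hasDerivAt_freeSol l ω ht)
  have h2 := (((besselY l).hasDerivAt ((Complex.I * ω * t)⁻¹)).comp t
    ((hasDerivAt_mul_ofReal t (Complex.I * ω)).inv hz)).const_mul ((Complex.I * ω) ^ l)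
  have h3 := h2.congr_of_eventuallyEq
    (f₁ := fun t : ℝ => Complex.exp (Complex.I * ω * t) * freeSol l ω t) (by
      filter_upwards [eventually_ne_nhds ht] with s hs
      exact exp_mul_freeSol l hω hs)
  have h4 := h1.unique h3
  rw [inv_pow, ← div_eq_mul_inv, ← h4]
  ring

theorem tendsto_exp_mul_freeSolDeriv (hω : ω ≠ 0) :
    Tendsto (fun t : ℝ => Complex.exp (Complex.I * ω * t) *
      (freeSolDeriv l ω t + Complex.I * ω * freeSol l ω t)) atTop (𝓝 0) := by
  have h0 := tendsto_inv_mul_ofReal (Complex.I * ω)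
  have h1 := ((((besselY l).derivative.continuous.tendsto 0).comp h0).mul
    ((h0.pow 2).const_mul (-(Complex.I * ω)))).const_mul ((Complex.I * ω) ^ l)
  simp only [ne_eq, OfNat.ofNat_ne_zero, not_false_eq_true, zero_pow, mul_zero] at h1
  refine h1.congr' ?_
  filter_upwards [eventually_ne_atTop 0] with t ht
  exact (exp_mul_freeSolDeriv l hω ht).symm

end Asymptotics

end Schwarzschild

/-! ### The radius and the potential in shifted coordinates -/

namespace Schwarzschild

open Set

variable {M : ℝ}

theorem radius_pos (hM : 0 < M) (u : ℝ) : 0 < radius M u := by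
  have := (radius_spec hM u).1
  linarith

theorem radius_div_sub_one_pos (hM : 0 < M) (u : ℝ) : 0 < radius M u / (2 * M) - 1 := by
  have h := (radius_spec hM u).1
  rw [sub_pos, one_lt_div (by positivity)]
  exact h

theorem radius_eq (hM : 0 < M) (u : ℝ) :
    u = radius M u + 2 * M * Real.log (radius M u / (2 * M) - 1) :=
  ((radius_spec hM u).2).symm

/-- In `u - v` the increments of `r` and of `2M log(r/(2M) - 1)` have the same sign, so neither
exceeds the total. -/
theorem abs_radius_sub_le (hM : 0 < M) (u v : ℝ) : |radius M u - radius M v| ≤ |u - v| := by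
  wlog h : radius M v ≤ radius M u generalizing u v
  · rw [abs_sub_comm, abs_sub_comm u]
    exact this v u (le_of_not_ge h)
  have h1 : Real.log (radius M v / (2 * M) - 1) ≤ Real.log (radius M u / (2 * M) - 1) := by
    refine Real.log_le_log (radius_div_sub_one_pos hM v) ?_
    gcongr
  have h2 := radius_eq hM u
  have h3 := radius_eq hM v
  rw [abs_of_nonneg (by linarith)]
  refine le_trans ?_ (le_abs_self _)
  nlinarith

theorem continuous_radius (hM : 0 < M) : Continuous (radius M) := by
  have : LipschitzWith 1 (radius M) := LipschitzWith.of_dist_le_mul fun u v => by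
    simpa [Real.dist_eq] using abs_radius_sub_le hM u v
  exact this.continuous

theorem continuous_potential (hM : 0 < M) (l : ℕ) : Continuous (potential M l) := by
  have h := continuous_radius hM
  have h0 : ∀ u, radius M u ≠ 0 := fun u => (radius_pos hM u).ne'
  unfold potential
  fun_prop (disch := simp [h0])

/-- `log x ≤ x - 1` gives `t + a ≤ 2r - 4M`, and `r > 2M` absorbs `|a|`. -/
theorem le_mul_radius (hM : 0 < M) (a t : ℝ) :
    t ≤ (2 + |a| / (2 * M)) * radius M (t + a) := by
  have h1 := radius_eq hM (t + a)
  have h2 := (radius_spec hM (t + a)).1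
  have h3 := Real.log_le_sub_one_of_pos (radius_div_sub_one_pos hM (t + a))
  set r := radius M (t + a)
  have h4 : 2 * M * Real.log (r / (2 * M) - 1) ≤ 2 * M * (r / (2 * M) - 1 - 1) := by gcongr
  have h5 : 2 * M * (r / (2 * M) - 1 - 1) = r - 4 * M := by field_simp; ring
  have h6 : |a| ≤ |a| / (2 * M) * r := by
    rw [div_mul_eq_mul_div, le_div_iff₀ (by positivity)]
    gcongr
  have := neg_abs_le a
  nlinarith

theorem radius_le_mul (hM : 0 < M) (a : ℝ) {t : ℝ} (ht : 1 ≤ t) :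
    radius M (t + a) ≤ (1 + |a| + 4 * M) * t := by
  have h1 := radius_eq hM (t + a)
  have h2 := le_abs_self a
  have h3 := abs_nonneg a
  set r := radius M (t + a)
  rcases le_or_gt (4 * M) r with h | h
  · have h4 : 0 ≤ Real.log (r / (2 * M) - 1) := by
      refine Real.log_nonneg ?_
      rw [le_sub_iff_add_le, le_div_iff₀ (by positivity)]
      linarith
    have h5 : 0 ≤ 2 * M * Real.log (r / (2 * M) - 1) := by positivity
    nlinarith
  · nlinarith

/-- The difference is a logarithm up to a constant, and `log x = 2 log √x ≤ 2√x`. The crude `√t`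
suffices: it leaves `W = O(t^(-5/2))`, integrable twice at infinity. The case split is at `r = 4M`,
where the logarithm changes sign. -/
theorem exists_abs_radius_sub_le_sqrt (hM : 0 < M) (a : ℝ) : ∃ B : ℝ, 0 ≤ B ∧
    ∀ t : ℝ, 1 ≤ t → |t - radius M (t + a)| ≤ B * √t := by
  refine ⟨4 * M * √((1 + |a| + 4 * M) / (2 * M)) + |a| + 4 * M, by positivity, fun t ht => ?_⟩
  have h1 := radius_eq hM (t + a)
  have hx := radius_div_sub_one_pos hM (t + a)
  have hr := radius_le_mul hM a ht
  set r := radius M (t + a)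
  have hst : 1 ≤ √t := Real.one_le_sqrt.2 ht
  have ha := abs_nonneg a
  have hle := le_abs_self a
  have hnle := neg_abs_le a
  have hB : 0 ≤ √((1 + |a| + 4 * M) / (2 * M)) * √t := by positivity
  rw [abs_le]
  constructor
  · rcases le_or_gt (4 * M) r with h | h
    · have h4 : 0 ≤ Real.log (r / (2 * M) - 1) := by
        refine Real.log_nonneg ?_
        rw [le_sub_iff_add_le, le_div_iff₀ (by positivity)]
        linarith
      have h5 : 0 ≤ 2 * M * Real.log (r / (2 * M) - 1) := by positivity
      nlinarith
    · nlinarith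
  · have h2 : Real.log (r / (2 * M) - 1) ≤ 2 * √(r / (2 * M) - 1) := by
      have := Real.log_le_sub_one_of_pos (Real.sqrt_pos.2 hx)
      rw [Real.log_sqrt hx.le] at this
      linarith
    have h3 : √(r / (2 * M) - 1) ≤ √((1 + |a| + 4 * M) / (2 * M)) * √t := by
      rw [← Real.sqrt_mul (by positivity)]
      refine Real.sqrt_le_sqrt ?_
      have : r / (2 * M) ≤ (1 + |a| + 4 * M) * t / (2 * M) := by gcongr
      rw [div_mul_eq_mul_div]
      linarith
    have h4 : 2 * M * Real.log (r / (2 * M) - 1) ≤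
        2 * M * (2 * (√((1 + |a| + 4 * M) / (2 * M)) * √t)) := by
      gcongr
      exact h2.trans (by gcongr)
    nlinarith

/-- In any shifted coordinate the potential is the centrifugal potential up to an integrable
error. -/
theorem exists_abs_potential_sub_le (hM : 0 < M) (l : ℕ) (a : ℝ) : ∃ A : ℝ, 0 < A ∧
    ∀ t : ℝ, 1 ≤ t → |potential M l (t + a) - (l : ℝ) * (l + 1) / t ^ 2| ≤
      A * t ^ (-5 / 2 : ℝ) := by
  obtain ⟨B, hB0, hB⟩ := exists_abs_radius_sub_le_sqrt hM a
  set c₁ := 2 + |a| / (2 * M) with hc₁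
  set c₂ := 1 + |a| + 4 * M with hc₂
  have hc₁0 : 0 < c₁ := by positivity
  have hc₂0 : 0 < c₂ := by positivity
  set L : ℝ := (l : ℝ) * (l + 1) with hL
  have hL0 : 0 ≤ L := by positivity
  -- The first summand collects the `1/r³` terms. The second bounds `1/r² - 1/t² = (t - r)(t +
  -- r)/(r² t²)`, of order `√t · t / t⁴`.
  refine ⟨(2 * M + 2 * M * L) * c₁ ^ 3 + L * (B * (1 + c₂) * c₁ ^ 2), by positivity,
    fun t ht => ?_⟩
  have ht0 : 0 < t := by linarith
  have hpow : t ^ (-5 / 2 : ℝ) = (t ^ 2 * √t)⁻¹ := by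
    rw [Real.sqrt_eq_rpow, ← Real.rpow_natCast t 2, ← Real.rpow_add ht0, ← Real.rpow_neg ht0.le]
    norm_num
  have h1 := le_mul_radius hM a t
  have h2 := radius_le_mul hM a ht
  have h3 := hB t ht
  have h2M := (radius_spec hM (t + a)).1
  have hr0 := radius_pos hM (t + a)
  rw [potential]
  set r := radius M (t + a)
  have hs : 1 ≤ √t := Real.one_le_sqrt.2 ht
  have hss : √t * √t = t := Real.mul_self_sqrt ht0.le
  have hst : √t ≤ t := by nlinarith
  have hr3 : 1 / r ^ 3 ≤ c₁ ^ 3 * (t ^ 2 * √t)⁻¹ := by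
    rw [← div_eq_mul_inv, div_le_div_iff₀ (by positivity) (by positivity), one_mul]
    calc t ^ 2 * √t ≤ t ^ 2 * t := by gcongr
      _ = t ^ 3 := by ring
      _ ≤ (c₁ * r) ^ 3 := by gcongr
      _ = _ := by ring
  have hr2 : |1 / r ^ 2 - 1 / t ^ 2| ≤ B * (1 + c₂) * c₁ ^ 2 * (t ^ 2 * √t)⁻¹ := by
    have e1 : 1 / r ^ 2 - 1 / t ^ 2 = (t - r) * (t + r) * (1 / r ^ 2) / t ^ 2 := by
      field_simp
      ring
    have e2 : 1 / r ^ 2 ≤ c₁ ^ 2 / t ^ 2 := by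
      rw [div_le_div_iff₀ (by positivity) (by positivity), one_mul, ← mul_pow]
      gcongr
    have e3 : (t ^ 2 * √t)⁻¹ = √t * t / (t ^ 2 * t ^ 2) := by
      rw [inv_eq_one_div, div_eq_div_iff (by positivity) (by positivity)]
      calc _ = t ^ 3 * t := by ring
        _ = t ^ 3 * (√t * √t) := by rw [hss]
        _ = _ := by ring
    rw [e1, abs_div, abs_mul, abs_mul, abs_of_pos (show 0 < t + r by linarith),
      abs_of_pos (show 0 < 1 / r ^ 2 by positivity), abs_of_pos (show 0 < t ^ 2 by positivity), e3]
    calc |t - r| * (t + r) * (1 / r ^ 2) / t ^ 2 ≤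
        (B * √t) * (t + c₂ * t) * (c₁ ^ 2 / t ^ 2) / t ^ 2 := by gcongr
      _ = _ := by
        field_simp
  have hq : |1 - 2 * M / r| ≤ 1 := by
    have : 2 * M / r ≤ 1 := (div_le_one hr0).2 h2M.le
    have : 0 ≤ 2 * M / r := by positivity
    rw [abs_le]
    constructor <;> linarith
  have hsplit : (1 - 2 * M / r) * (2 * M / r ^ 3 + L / r ^ 2) - L / t ^ 2 =
      (1 - 2 * M / r) * (2 * M * (1 / r ^ 3)) - 2 * M * L * (1 / r ^ 3) +
        L * (1 / r ^ 2 - 1 / t ^ 2) := by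
    field_simp
    ring
  have hr30 : 0 < 1 / r ^ 3 := by positivity
  rw [hsplit, hpow]
  calc _ ≤ |(1 - 2 * M / r) * (2 * M * (1 / r ^ 3))| + |2 * M * L * (1 / r ^ 3)| +
        |L * (1 / r ^ 2 - 1 / t ^ 2)| :=
        (abs_add_le _ _).trans (add_le_add_left (abs_sub _ _) _)
    _ = |1 - 2 * M / r| * (2 * M * (1 / r ^ 3)) + 2 * M * L * (1 / r ^ 3) +
        L * |1 / r ^ 2 - 1 / t ^ 2| := by
        rw [abs_mul, abs_mul L, abs_of_nonneg hL0,
          abs_of_nonneg (show 0 ≤ 2 * M * (1 / r ^ 3) by positivity),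
          abs_of_nonneg (show 0 ≤ 2 * M * L * (1 / r ^ 3) by positivity)]
    _ ≤ 1 * (2 * M * (c₁ ^ 3 * (t ^ 2 * √t)⁻¹)) + 2 * M * L * (c₁ ^ 3 * (t ^ 2 * √t)⁻¹) +
        L * (B * (1 + c₂) * c₁ ^ 2 * (t ^ 2 * √t)⁻¹) := by gcongr
    _ = _ := by ring

end Schwarzschild

/-! ### Uniqueness of Jost solutions and gluing -/

namespace Schwarzschild

open Set

/-- `(φ, φ')` solves the first order system of `φ'' = (-ω² + V) φ` on `(b, ∞)`. -/
def IsSolutionOn (V : ℝ → ℝ) (ω : ℂ) (b : ℝ) (φ ψ : ℝ → ℂ) : Prop :=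
  ∀ u, b < u → HasDerivAt φ (ψ u) u ∧ HasDerivAt ψ ((-ω ^ 2 + (V u : ℂ)) * φ u) u

/-- A solution on `(b, ∞)` with the Jost boundary conditions at `+∞`. -/
structure IsJostOn (V : ℝ → ℝ) (ω : ℂ) (b : ℝ) (φ ψ : ℝ → ℂ) : Prop where
  sol : IsSolutionOn V ω b φ ψ
  tendsto_one : Tendsto (fun u : ℝ => Complex.exp (Complex.I * ω * u) * φ u) atTop (𝓝 1)
  tendsto_zero : Tendsto (fun u : ℝ => Complex.exp (Complex.I * ω * u) *
    (ψ u + Complex.I * ω * φ u)) atTop (𝓝 0)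

variable {V : ℝ → ℝ} {ω : ℂ} {b : ℝ} {φ ψ φ₁ ψ₁ φ₂ ψ₂ : ℝ → ℂ}

theorem IsSolutionOn.mono {b' : ℝ} (h : IsSolutionOn V ω b φ ψ) (hb : b ≤ b') :
    IsSolutionOn V ω b' φ ψ := fun u hu => h u (hb.trans_lt hu)

theorem IsJostOn.mono {b' : ℝ} (h : IsJostOn V ω b φ ψ) (hb : b ≤ b') : IsJostOn V ω b' φ ψ :=
  ⟨h.sol.mono hb, h.tendsto_one, h.tendsto_zero⟩

theorem IsSolutionOn.sub (h₁ : IsSolutionOn V ω b φ₁ ψ₁) (h₂ : IsSolutionOn V ω b φ₂ ψ₂) :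
    IsSolutionOn V ω b (fun u => φ₁ u - φ₂ u) (fun u => ψ₁ u - ψ₂ u) := fun u hu =>
  ⟨(h₁ u hu).1.sub (h₂ u hu).1, ((h₁ u hu).2.sub (h₂ u hu).2).congr_deriv (by ring)⟩

/-- The Wronskian is constant. -/
theorem IsSolutionOn.wronskian_eq (h₁ : IsSolutionOn V ω b φ₁ ψ₁)
    (h₂ : IsSolutionOn V ω b φ₂ ψ₂) {u v : ℝ} (hu : b < u) (hv : b < v) :
    φ₁ u * ψ₂ u - ψ₁ u * φ₂ u = φ₁ v * ψ₂ v - ψ₁ v * φ₂ v := by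
  have h : ∀ x ∈ Ioi b, HasDerivAt (fun x => φ₁ x * ψ₂ x - ψ₁ x * φ₂ x) 0 x := fun x hx =>
    (((h₁ x hx).1.mul (h₂ x hx).2).sub ((h₁ x hx).2.mul (h₂ x hx).1)).congr_deriv (by ring)
  exact isOpen_Ioi.is_const_of_deriv_eq_zero isPreconnected_Ioi
    (fun x hx => (h x hx).differentiableAt.differentiableWithinAt)
    (fun x hx => (h x hx).deriv) hu hv

/-- A solution with vanishing Cauchy data at `v` vanishes to the left of `v`. -/
theorem IsSolutionOn.eq_zero (hV : Continuous V) (h : IsSolutionOn V ω b φ ψ) {u v : ℝ}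
    (hu : b < u) (huv : u ≤ v) (h0 : φ v = 0) (h1 : ψ v = 0) : φ u = 0 ∧ ψ u = 0 := by
  have hQ : Continuous fun t : ℝ => ‖-ω ^ 2 + (V t : ℂ)‖ := by fun_prop
  obtain ⟨K, hK⟩ := isCompact_Icc.bddAbove_image (hQ.continuousOn (s := Icc u v))
  let F : ℝ → ℂ × ℂ → ℂ × ℂ := fun t p => (p.2, (-ω ^ 2 + (V t : ℂ)) * p.1)
  have hF : ∀ t ∈ Ioc u v, LipschitzOnWith (max 1 K.toNNReal) (F t) univ := by
    intro t ht
    refine LipschitzOnWith.of_dist_le_mul fun p _ q _ => ?_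
    have hKt : ‖-ω ^ 2 + (V t : ℂ)‖ ≤ K := hK ⟨t, ⟨ht.1.le, ht.2⟩, rfl⟩
    rw [dist_eq_norm, dist_eq_norm, Prod.norm_def]
    refine max_le ?_ ?_
    · calc ‖(p - q).2‖ ≤ 1 * ‖p - q‖ := by rw [one_mul]; exact norm_snd_le _
        _ ≤ _ := by
          gcongr
          simp
    · have : (F t p - F t q).2 = (-ω ^ 2 + (V t : ℂ)) * (p - q).1 := by simp [F]; ring
      rw [this, norm_mul]
      gcongr
      · refine hKt.trans ((Real.le_coe_toNNReal K).trans ?_)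
        simp
      · exact norm_fst_le _
  have hd : ∀ t, b < t → HasDerivAt (fun t => (φ t, ψ t)) (F t (φ t, ψ t)) t := fun t ht =>
    (h t ht).1.prodMk (h t ht).2
  have h00 : ∀ t : ℝ, HasDerivAt (fun _ : ℝ => (0 : ℂ × ℂ)) (F t 0) t := fun t =>
    (hasDerivAt_const t (0 : ℂ × ℂ)).congr_deriv (by simp [F, Prod.ext_iff])
  have key := ODE_solution_unique_of_mem_Icc_left hF
    (f := fun t => (φ t, ψ t)) (g := fun _ => 0)
    (fun t ht => (hd t (hu.trans_le ht.1)).continuousAt.continuousWithinAt)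
    (fun t ht => (hd t (hu.trans ht.1)).hasDerivWithinAt) (fun _ _ => mem_univ _)
    continuousOn_const (fun t _ => (h00 t).hasDerivWithinAt) (fun _ _ => mem_univ _)
    (by simp [h0, h1]) ⟨le_rfl, huv⟩
  simpa using key

/-- Jost solutions are unique. -/
theorem IsJostOn.unique (hV : Continuous V) (hω : ω.im ≤ 0) (h₁ : IsJostOn V ω b φ₁ ψ₁)
    (h₂ : IsJostOn V ω b φ₂ ψ₂) {u : ℝ} (hu : b < u) : φ₁ u = φ₂ u ∧ ψ₁ u = ψ₂ u := by
  have hd := h₁.sol.sub h₂.sol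
  set d : ℝ → ℂ := fun u => φ₁ u - φ₂ u with hd_def
  set δ : ℝ → ℂ := fun u => ψ₁ u - ψ₂ u with hδ_def
  have hd0 : Tendsto (fun u : ℝ => Complex.exp (Complex.I * ω * u) * d u) atTop (𝓝 0) := by
    have := h₁.tendsto_one.sub h₂.tendsto_one
    rw [sub_self] at this
    exact this.congr fun u => by rw [hd_def]; ring
  have hδ0 : Tendsto (fun u : ℝ => Complex.exp (Complex.I * ω * u) *
      (δ u + Complex.I * ω * d u)) atTop (𝓝 0) := by
    have := h₁.tendsto_zero.sub h₂.tendsto_zero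
    rw [sub_self] at this
    exact this.congr fun u => by rw [hd_def, hδ_def]; ring
  -- The Wronskian of `φ₁` and `d` is constant. Times `e^{2iωs}` it tends to `0`, and `|e^{iωs}| ≥
  -- 1` for `s ≥ 0` as `Im ω ≤ 0`; so it vanishes.
  have hW : ∀ v, b < v → φ₁ v * δ v - ψ₁ v * d v = 0 := by
    intro v hv
    have h1 := (h₁.tendsto_one.mul hδ0).sub (h₁.tendsto_zero.mul hd0)
    simp only [mul_zero, sub_zero] at h1
    have h2 : Tendsto (fun _ : ℝ => φ₁ v * δ v - ψ₁ v * d v) atTop (𝓝 0) := by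
      have h1' := h1.norm
      rw [norm_zero] at h1'
      refine squeeze_zero_norm' ?_ h1'
      filter_upwards [eventually_gt_atTop b, eventually_ge_atTop 0] with s hs hs0
      rw [h₁.sol.wronskian_eq hd hv hs]
      have h3 : Complex.exp (Complex.I * ω * s) * φ₁ s * (Complex.exp (Complex.I * ω * s) *
          (δ s + Complex.I * ω * d s)) - Complex.exp (Complex.I * ω * s) *
          (ψ₁ s + Complex.I * ω * φ₁ s) * (Complex.exp (Complex.I * ω * s) * d s) =
          Complex.exp (Complex.I * ω * s) ^ 2 * (φ₁ s * δ s - ψ₁ s * d s) := by ring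
      rw [h3, norm_mul, norm_pow]
      have h4 : 1 ≤ ‖Complex.exp (Complex.I * ω * s)‖ := by
        rw [Complex.norm_exp]
        refine Real.one_le_exp ?_
        simp
        nlinarith
      exact le_mul_of_one_le_left (norm_nonneg _) (one_le_pow₀ h4)
    exact tendsto_nhds_unique tendsto_const_nhds h2
  have hne : ∀ᶠ s in atTop, φ₁ s ≠ 0 := by
    filter_upwards [h₁.tendsto_one.eventually_ne one_ne_zero] with s hs h0
    exact hs (by rw [h0, mul_zero])
  obtain ⟨v, hv⟩ := eventually_atTop.1 (hne.and (eventually_gt_atTop b))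
  have hbv : b < v := (hv v le_rfl).2
  -- Zero Wronskian makes `d` a constant multiple of `φ₁`; comparing the limits `0` and `1` at
  -- infinity, the constant is `0`.
  have hconst : ∀ s ∈ Ioi v, ∀ s' ∈ Ioi v, d s / φ₁ s = d s' / φ₁ s' := by
    have h : ∀ x ∈ Ioi v, HasDerivAt (fun x => d x / φ₁ x) 0 x := fun x hx => by
      obtain ⟨hx0, hxb⟩ := hv x (le_of_lt hx)
      refine ((hd x hxb).1.div (h₁.sol x hxb).1 hx0).congr_deriv ?_
      rw [div_eq_zero_iff]
      left
      have := hW x hxb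
      linear_combination this
    intro s hs s' hs'
    exact isOpen_Ioi.is_const_of_deriv_eq_zero isPreconnected_Ioi
      (fun x hx => (h x hx).differentiableAt.differentiableWithinAt)
      (fun x hx => (h x hx).deriv) hs hs'
  have hd_zero : ∀ s, v < s → d s = 0 := by
    intro s hs
    have h1 : Tendsto (fun x : ℝ => Complex.exp (Complex.I * ω * x) * d x) atTop
        (𝓝 (d s / φ₁ s * 1)) := by
      refine (h₁.tendsto_one.const_mul (d s / φ₁ s)).congr' ?_
      filter_upwards [eventually_gt_atTop v] with x hx
      have hx0 := (hv x hx.le).1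
      rw [hconst s hs x hx]
      field_simp
    have h2 := tendsto_nhds_unique h1 hd0
    rw [mul_one, div_eq_zero_iff] at h2
    exact h2.resolve_right (hv s hs.le).1
  have hδ_zero : ∀ s, v < s → δ s = 0 := by
    intro s hs
    have := hW s (hbv.trans hs)
    rw [hd_zero s hs, mul_zero, sub_zero] at this
    exact (mul_eq_zero.1 this).resolve_left (hv s hs.le).1
  have hlt : v < max u v + 1 := (le_max_right u v).trans_lt (lt_add_one _)
  have := hd.eq_zero hV hu ((le_max_left u v).trans (lt_add_one _).le)
    (hd_zero _ hlt) (hδ_zero _ hlt)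
  exact ⟨sub_eq_zero.1 this.1, sub_eq_zero.1 this.2⟩

/-- Compatible solutions on `(-n, ∞)` glue to a solution on `ℝ`. -/
theorem exists_global_solution {Φ Ψ : ℕ → ℝ → ℂ}
    (hsol : ∀ n : ℕ, IsSolutionOn V ω (-n) (Φ n) (Ψ n))
    (hcompat : ∀ (n m : ℕ) (u : ℝ), -(n : ℝ) < u → -(m : ℝ) < u →
      Φ n u = Φ m u ∧ Ψ n u = Ψ m u) :
    ∃ φ ψ : ℝ → ℂ, (∀ b, IsSolutionOn V ω b φ ψ) ∧
      ∀ (n : ℕ) (u : ℝ), -(n : ℝ) < u → φ u = Φ n u ∧ ψ u = Ψ n u := by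
  -- The `+ 1` makes the inequality from the ceiling strict, so the chosen half-line contains a
  -- neighbourhood of `u`.
  have hN : ∀ u : ℝ, -((⌈-u⌉₊ + 1 : ℕ) : ℝ) < u := fun u => by
    have := Nat.le_ceil (-u)
    push_cast
    linarith
  have key : ∀ (n : ℕ) (u : ℝ), -(n : ℝ) < u →
      Φ (⌈-u⌉₊ + 1) u = Φ n u ∧ Ψ (⌈-u⌉₊ + 1) u = Ψ n u := fun n u hu =>
    hcompat _ n u (hN u) hu
  refine ⟨fun u => Φ (⌈-u⌉₊ + 1) u, fun u => Ψ (⌈-u⌉₊ + 1) u, fun b u _ => ?_, key⟩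
  have h1 := hsol _ u (hN u)
  have h2 : ∀ᶠ v in 𝓝 u, -((⌈-u⌉₊ + 1 : ℕ) : ℝ) < v := lt_mem_nhds (hN u)
  exact ⟨h1.1.congr_of_eventuallyEq (h2.mono fun v hv => (key _ v hv).1),
    h1.2.congr_of_eventuallyEq (h2.mono fun v hv => (key _ v hv).2)⟩

section Radial

variable {M : ℝ} {l : ℕ}

theorem IsRadialSolution.isSolutionOn (h : IsRadialSolution M l ω φ) (b : ℝ) :
    IsSolutionOn (potential M l) ω b φ (deriv φ) := fun u _ =>
  ⟨(h.1 u).hasDerivAt, (h.2.1 u).hasDerivAt.congr_deriv (by linear_combination -h.2.2 u)⟩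

theorem deriv_eq_of_isSolutionOn (h : ∀ b, IsSolutionOn V ω b φ ψ) : deriv φ = ψ :=
  funext fun u => (h (u - 1) u (sub_one_lt u)).1.deriv

theorem isRadialSolution_of_isSolutionOn (h : ∀ b, IsSolutionOn (potential M l) ω b φ ψ) :
    IsRadialSolution M l ω φ := by
  have h' := fun u => h (u - 1) u (sub_one_lt u)
  have hφ := deriv_eq_of_isSolutionOn h
  refine ⟨fun u => (h' u).1.differentiableAt, ?_, fun u => ?_⟩
  · rw [hφ]
    exact fun u => (h' u).2.differentiableAt
  · rw [hφ, (h' u).2.deriv]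
    ring

theorem deriv_exp_mul {u : ℝ} {y : ℂ} (h : HasDerivAt φ y u) :
    deriv (fun u : ℝ => Complex.exp (Complex.I * ω * u) * φ u) u =
      Complex.exp (Complex.I * ω * u) * (y + Complex.I * ω * φ u) := by
  have := ((hasDerivAt_cexp_mul_ofReal u (Complex.I * ω)).mul h).deriv
  refine Eq.trans this ?_
  ring

theorem IsJostSolutionAtTop.isJostOn (h : IsJostSolutionAtTop M l ω φ) (b : ℝ) :
    IsJostOn (potential M l) ω b φ (deriv φ) := by
  refine ⟨h.1.isSolutionOn b, h.2.1, h.2.2.congr fun u => ?_⟩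
  exact deriv_exp_mul (h.1.1 u).hasDerivAt

theorem isJostSolutionAtTop_of_isJostOn (h : ∀ b, IsJostOn (potential M l) ω b φ ψ) :
    IsJostSolutionAtTop M l ω φ := by
  refine ⟨isRadialSolution_of_isSolutionOn fun b => (h b).sol, (h 0).tendsto_one,
    (h 0).tendsto_zero.congr fun u => ?_⟩
  exact (deriv_exp_mul ((h (u - 1)).sol u (sub_one_lt u)).1).symm

end Radial

end Schwarzschild

/-! ### The Jost family, its low energy limit and the main theorem -/

namespace Schwarzschild

open Set

variable {M : ℝ}

/-- Makes limits along `E ∋ ω → 0` unique, which the gluing of the zero energy solution relies on.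
-/
instance neBot_nhdsWithin_lowerHalfPlane : (𝓝[lowerHalfPlane] (0 : ℂ)).NeBot := by
  have h1 : Tendsto (fun n : ℕ => ((1 / ((n : ℝ) + 1) : ℝ) : ℂ)) atTop (𝓝 0) := by
    have := (Complex.continuous_ofReal.tendsto 0).comp
      (tendsto_one_div_add_atTop_nhds_zero_nat (𝕜 := ℝ))
    rwa [Complex.ofReal_zero] at this
  refine (tendsto_nhdsWithin_iff.2 ⟨h1, Eventually.of_forall fun n => ?_⟩).neBot
  refine ⟨(Complex.ofReal_im _).le, ?_⟩
  rw [Complex.ofReal_ne_zero]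
  positivity

theorem hasDerivAt_comp_sub_const {f : ℝ → ℂ} {y c : ℂ} {u a : ℝ} (h : HasDerivAt f y (u - a)) :
    HasDerivAt (fun u => c * f (u - a)) (c * y) u :=
  (h.comp_sub_const u a).const_mul c

/-- Jost solutions near `+∞` and their low energy limit. -/
theorem exists_jost_family (hM : 0 < M) (l : ℕ) (a : ℝ) :
    ∃ Φ Ψ : ℂ → ℝ → ℂ, ∃ φ₀ ψ₀ : ℝ → ℂ,
      (∀ ω ∈ lowerHalfPlane, IsJostOn (potential M l) ω (a + 1) (Φ ω) (Ψ ω)) ∧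
      IsSolutionOn (potential M l) 0 (a + 1) φ₀ ψ₀ ∧
      Tendsto (fun u : ℝ => (u : ℂ) ^ l * φ₀ u) atTop
        (𝓝 ((-Complex.I) ^ l * (Nat.doubleFactorial (2 * l - 1) : ℂ))) ∧
      ∀ u, a + 1 < u →
        Tendsto (fun ω => ω ^ l * Φ ω u) (𝓝[lowerHalfPlane] 0) (𝓝 (φ₀ u)) ∧
        Tendsto (fun ω => ω ^ l * Ψ ω u) (𝓝[lowerHalfPlane] 0) (𝓝 (ψ₀ u)) := by
  obtain ⟨K, hK1, hK⟩ := exists_norm_freeSol_le l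
  obtain ⟨A, hA, hWA⟩ := exists_abs_potential_sub_le hM l a
  set W : ℝ → ℂ := fun t => ((potential M l (t + a) - (l : ℝ) * (l + 1) / t ^ 2 : ℝ) : ℂ)
    with hW_def
  have hW : ContinuousOn W (Ici 1) := by
    refine Complex.continuous_ofReal.comp_continuousOn ?_
    refine ((continuous_potential hM l).comp (by fun_prop)).continuousOn.sub ?_
    refine continuousOn_const.div (by fun_prop) fun t ht => ?_
    have : 0 < t := lt_of_lt_of_le one_pos ht
    positivity
  have hker : ∀ {ω : ℂ}, ω.im ≤ 0 → VolterraKernel (freeSol l ω) W (K ^ 2) A := fun hω =>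
    volterraKernel_freeSol hK1 hK hW hA (fun s hs => by
      rw [hW_def, Complex.norm_real]
      exact hWA s hs) hω
  -- Stated for every `ω` so that `choose` yields a total family; the value `0` off the half plane
  -- is a dummy.
  have hex : ∀ ω : ℂ, ∃ g : ℝ → ℂ, ω.im ≤ 0 → ContinuousOn g (Ici 1) ∧
      (∀ t, 1 ≤ t → g t = 1 + volterraOp (freeSol l ω) W g t) ∧
      ∀ t, 1 ≤ t → ‖g t‖ ≤ 2 * Real.exp (8 / 3 * (K ^ 2 * A)) := fun ω => by
    by_cases hω : ω.im ≤ 0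
    · obtain ⟨g, hg⟩ := (hker hω).exists_solution
      exact ⟨g, fun _ => hg⟩
    · exact ⟨0, fun h => absurd h hω⟩
  choose g hg using hex
  set X : ℂ → ℝ → ℂ := fun ω t => freeSol l ω t * g ω t with hX
  set Y : ℂ → ℝ → ℂ := fun ω t => freeSolDeriv l ω t * g ω t -
    freeSol l ω t * volterraTail (freeSol l ω) W (g ω) t with hY
  have hsol : ∀ ω : ℂ, ω.im ≤ 0 → ∀ c : ℂ, IsSolutionOn (potential M l) ω (a + 1)
      (fun u => c * X ω (u - a)) (fun u => c * Y ω (u - a)) := by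
    intro ω hω c u hu
    obtain ⟨h1, h2, h3⟩ := hg ω hω
    have hu1 : 1 < u - a := by linarith
    have h := (hker hω).hasDerivAt_mul_solution h1 h3 h2 hu1
      (hasDerivAt_freeSol l ω (by linarith)) (hasDerivAt_freeSolDeriv l ω (by linarith))
    refine ⟨hasDerivAt_comp_sub_const h.1, (hasDerivAt_comp_sub_const h.2).congr_deriv ?_⟩
    simp only [hW_def, hX, sub_add_cancel]
    push_cast
    ring
  have hshift : Tendsto (fun u : ℝ => u - a) atTop atTop :=
    tendsto_atTop_add_const_right _ _ tendsto_id
  have hev : ∀ᶠ ω in 𝓝[lowerHalfPlane] (0 : ℂ), ω ∈ lowerHalfPlane := self_mem_nhdsWithin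
  have hg0 := hg 0 (by simp)
  have hpt : ∀ t : ℝ, Tendsto (fun ω => freeSol l ω t) (𝓝[lowerHalfPlane] 0)
      (𝓝 (freeSol l 0 t)) := fun t =>
    ((continuous_freeSol_param l t).tendsto 0).mono_left nhdsWithin_le_nhds
  have hpt' : ∀ t : ℝ, Tendsto (fun ω => freeSolDeriv l ω t) (𝓝[lowerHalfPlane] 0)
      (𝓝 (freeSolDeriv l 0 t)) := fun t =>
    ((continuous_freeSolDeriv_param l t).tendsto 0).mono_left nhdsWithin_le_nhds
  have hKev : ∀ᶠ ω in 𝓝[lowerHalfPlane] (0 : ℂ),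
      VolterraKernel (freeSol l ω) W (K ^ 2) A := hev.mono fun ω hω => hker hω.1
  have hGev : ∀ᶠ ω in 𝓝[lowerHalfPlane] (0 : ℂ), ContinuousOn (g ω) (Ici 1) ∧
      ∀ s, 1 ≤ s → ‖g ω s‖ ≤ 2 * Real.exp (8 / 3 * (K ^ 2 * A)) :=
    hev.mono fun ω hω => ⟨(hg ω hω.1).1, (hg ω hω.1).2.2⟩
  have hglim : ∀ t, 1 ≤ t → Tendsto (fun ω => g ω t) (𝓝[lowerHalfPlane] 0) (𝓝 (g 0 t)) :=
    fun t ht => (hker (by simp)).tendsto_solution hKev (fun t _ => hpt t) hGev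
      (hev.mono fun ω hω => (hg ω hω.1).2.1) hg0.1 hg0.2.2 hg0.2.1 ht
  have htlim : ∀ t, 1 ≤ t → Tendsto (fun ω => volterraTail (freeSol l ω) W (g ω) t)
      (𝓝[lowerHalfPlane] 0) (𝓝 (volterraTail (freeSol l 0) W (g 0) t)) :=
    fun t ht => (hker (by simp)).tendsto_tail hKev (fun t _ => hpt t) hGev hglim ht
  have hscale : ∀ (Z : ℂ → ℝ → ℂ) (t : ℝ),
      Tendsto (fun ω => Z ω t) (𝓝[lowerHalfPlane] 0) (𝓝 (Z 0 t)) →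
      Tendsto (fun ω => ω ^ l * (Complex.exp (-(Complex.I * ω * a)) / (Complex.I * ω) ^ l * Z ω t))
        (𝓝[lowerHalfPlane] 0) (𝓝 ((-Complex.I) ^ l * Z 0 t)) := by
    intro Z t hZ
    have h1 : Tendsto (fun ω : ℂ => Complex.exp (-(Complex.I * ω * a))) (𝓝[lowerHalfPlane] 0)
        (𝓝 1) := by
      have : Continuous fun ω : ℂ => Complex.exp (-(Complex.I * ω * a)) := by fun_prop
      have h := this.tendsto 0
      simp only [mul_zero, zero_mul, neg_zero, Complex.exp_zero] at h
      exact h.mono_left nhdsWithin_le_nhds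
    have h2 := (h1.mul hZ).const_mul ((-Complex.I) ^ l)
    rw [one_mul] at h2
    refine h2.congr' (hev.mono fun ω hω => ?_)
    have hω0 : ω ≠ 0 := hω.2
    have hI : (-Complex.I) ^ l = (Complex.I ^ l)⁻¹ := by rw [← inv_pow, Complex.inv_I]
    have hI0 := Complex.I_ne_zero
    simp only [hI, mul_pow]
    field_simp
  -- The prefactor normalises: `e^{iωt} h → (iω)^l`, and `e^{-iωa}` accounts for `u = t + a`.
  refine ⟨fun ω u => Complex.exp (-(Complex.I * ω * a)) / (Complex.I * ω) ^ l * X ω (u - a),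
    fun ω u => Complex.exp (-(Complex.I * ω * a)) / (Complex.I * ω) ^ l * Y ω (u - a),
    fun u => (-Complex.I) ^ l * X 0 (u - a), fun u => (-Complex.I) ^ l * Y 0 (u - a),
    fun ω hω => ⟨hsol ω hω.1 _, ?_, ?_⟩, hsol 0 (by simp) _, ?_, fun u hu => ?_⟩
  · obtain ⟨h1, h2, h3⟩ := hg ω hω.1
    have hω0 : (Complex.I * ω) ^ l ≠ 0 := pow_ne_zero _ (mul_ne_zero Complex.I_ne_zero hω.2)
    have h4 := (((tendsto_exp_mul_freeSol l hω.2).mul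
      (VolterraKernel.tendsto_solution_atTop h2)).const_mul ((Complex.I * ω) ^ l)⁻¹).comp hshift
    rw [mul_one, inv_mul_cancel₀ hω0] at h4
    refine h4.congr fun u => ?_
    have h5 : Complex.exp (Complex.I * ω * u) = Complex.exp (Complex.I * ω * (u - a : ℝ)) *
        Complex.exp (Complex.I * ω * a) := by
      rw [← Complex.exp_add]
      push_cast
      ring_nf
    simp only [hX, Function.comp]
    rw [h5, Complex.exp_neg]
    have := Complex.exp_ne_zero (Complex.I * ω * a)
    field_simp
  · obtain ⟨h1, h2, h3⟩ := hg ω hω.1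
    have hω0 : (Complex.I * ω) ^ l ≠ 0 := pow_ne_zero _ (mul_ne_zero Complex.I_ne_zero hω.2)
    have h4 := ((((tendsto_exp_mul_freeSolDeriv l hω.2).mul
      (VolterraKernel.tendsto_solution_atTop h2)).sub ((tendsto_exp_mul_freeSol l hω.2).mul
      ((hker hω.1).tendsto_tail_atTop h3))).const_mul ((Complex.I * ω) ^ l)⁻¹).comp hshift
    simp only [zero_mul, mul_zero, sub_zero] at h4
    refine h4.congr fun u => ?_
    have h5 : Complex.exp (Complex.I * ω * u) = Complex.exp (Complex.I * ω * (u - a : ℝ)) *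
        Complex.exp (Complex.I * ω * a) := by
      rw [← Complex.exp_add]
      push_cast
      ring_nf
    simp only [hX, hY, Function.comp]
    rw [h5, Complex.exp_neg]
    have := Complex.exp_ne_zero (Complex.I * ω * a)
    field_simp
    ring
  · have h1 : Tendsto (fun u : ℝ => (((u / (u - a) : ℝ) : ℂ)) ^ l) atTop (𝓝 1) := by
      have h2 : Tendsto (fun u : ℝ => 1 + a / (u - a)) atTop (𝓝 (1 + 0)) :=
        tendsto_const_nhds.add (tendsto_const_nhds.div_atTop hshift)
      have h3 : Tendsto (fun u : ℝ => u / (u - a)) atTop (𝓝 1) := by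
        rw [add_zero] at h2
        refine h2.congr' ?_
        filter_upwards [eventually_gt_atTop a] with u hu
        have : u - a ≠ 0 := by linarith
        field_simp
        ring
      have := ((Complex.continuous_ofReal.tendsto 1).comp h3).pow l
      rwa [Complex.ofReal_one, one_pow] at this
    have h2 := ((h1.mul ((VolterraKernel.tendsto_solution_atTop hg0.2.1).comp
      hshift)).const_mul ((-Complex.I) ^ l * (Nat.doubleFactorial (2 * l - 1) : ℂ)))
    rw [mul_one, mul_one] at h2
    refine h2.congr fun u => ?_
    simp only [hX, Function.comp, freeSol_zero]
    push_cast
    rw [div_pow]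
    ring
  · have hu1 : 1 ≤ u - a := by linarith
    refine ⟨hscale X (u - a) ((hpt _).mul (hglim _ hu1)), hscale Y (u - a) ?_⟩
    exact ((hpt' _).mul (hglim _ hu1)).sub ((hpt _).mul (htlim _ hu1))

/-- Induction by `Γ(s+1) = s Γ(s)` at `s = -(2l+1)/2`, where the double factorial gains `2l+1 =
-2s`. In product form it also shows that the Gamma value is nonzero. -/
theorem Gamma_half_sub_nat (l : ℕ) :
    Real.Gamma (1 / 2 - (l : ℝ)) * (Nat.doubleFactorial (2 * l - 1) : ℝ) * (-1) ^ l =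
      2 ^ l * √Real.pi := by
  induction l with
  | zero => simpa using Real.Gamma_one_half_eq
  | succ l ih =>
    have h0 : (1 / 2 - ((l + 1 : ℕ) : ℝ)) ≠ 0 := by
      push_cast
      have : (0 : ℝ) ≤ l := Nat.cast_nonneg l
      linarith
    have h1 := Real.Gamma_add_one h0
    have h2 : (1 / 2 - ((l + 1 : ℕ) : ℝ)) + 1 = 1 / 2 - (l : ℝ) := by
      push_cast
      ring
    have h3 : (Nat.doubleFactorial (2 * (l + 1) - 1) : ℝ) =
        (2 * l + 1) * (Nat.doubleFactorial (2 * l - 1) : ℝ) := by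
      rcases l with _ | l
      · simp
      · have e : 2 * (l + 1 + 1) - 1 = (2 * (l + 1) - 1) + 2 := by omega
        have e' : 2 * (l + 1) - 1 + 2 = 2 * (l + 1) + 1 := by omega
        rw [e, Nat.doubleFactorial_add_two, e']
        push_cast
        ring
    rw [h2] at h1
    rw [h1] at ih
    rw [h3, pow_succ, pow_succ]
    push_cast at *
    linear_combination 2 * ih

theorem I_pow_mul_Gamma (l : ℕ) :
    Complex.I ^ l * ((2 ^ l * √Real.pi / Real.Gamma (1 / 2 - (l : ℝ)) : ℝ) : ℂ) =
      (-Complex.I) ^ l * (Nat.doubleFactorial (2 * l - 1) : ℂ) := by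
  have h := Gamma_half_sub_nat l
  have hne : Real.Gamma (1 / 2 - (l : ℝ)) ≠ 0 := by
    intro h0
    rw [h0, zero_mul, zero_mul] at h
    have : 0 < 2 ^ l * √Real.pi := by positivity
    exact this.ne h
  have h1 : 2 ^ l * √Real.pi / Real.Gamma (1 / 2 - (l : ℝ)) =
      (-1) ^ l * (Nat.doubleFactorial (2 * l - 1) : ℝ) := by
    rw [← h, div_eq_iff hne]
    ring
  rw [h1, neg_pow Complex.I]
  push_cast
  ring

end Schwarzschild

theorem mainTheorem7 (M : ℝ) (hM : 0 < M) (l : ℕ) :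
    (∀ ω ∈ Schwarzschild.lowerHalfPlane,
      ∃! φ : ℝ → ℂ, Schwarzschild.IsJostSolutionAtTop M l ω φ) ∧
    ∃ φ₀ : ℝ → ℂ,
      Schwarzschild.IsRadialSolution M l 0 φ₀ ∧
      Tendsto (fun u : ℝ => (u : ℂ) ^ l * φ₀ u) atTop
        (𝓝 ((-Complex.I) ^ l * (Nat.doubleFactorial (2 * l - 1) : ℂ))) ∧
      Complex.I ^ l * ((2 ^ l * √Real.pi / Real.Gamma (1 / 2 - (l : ℝ)) : ℝ) : ℂ) =
        (-Complex.I) ^ l * (Nat.doubleFactorial (2 * l - 1) : ℂ) ∧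
      ∀ φ : ℂ → ℝ → ℂ,
        (∀ ω ∈ Schwarzschild.lowerHalfPlane,
          Schwarzschild.IsJostSolutionAtTop M l ω (φ ω)) →
        ∀ u : ℝ,
          Tendsto (fun ω : ℂ => ω ^ l * φ ω u)
            (𝓝[Schwarzschild.lowerHalfPlane] 0) (𝓝 (φ₀ u)) ∧
          Tendsto (fun ω : ℂ => ω ^ l * deriv (φ ω) u)
            (𝓝[Schwarzschild.lowerHalfPlane] 0) (𝓝 (deriv φ₀ u)) := by
  open Schwarzschild in
  have hV := continuous_potential hM l
  -- The shift `a = -n - 1` puts the left end `a + 1` at `-n`, so the half-lines exhaust `ℝ`.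
  have hfam := fun n : ℕ => exists_jost_family hM l (-(n : ℝ) - 1)
  simp only [sub_add_cancel] at hfam
  choose Φ Ψ φ₀ ψ₀ hJ hS hA hL using hfam
  have hcompat : ∀ ω ∈ lowerHalfPlane, ∀ (n m : ℕ) (u : ℝ), -(n : ℝ) < u → -(m : ℝ) < u →
      Φ n ω u = Φ m ω u ∧ Ψ n ω u = Ψ m ω u := fun ω hω n m u hn hm =>
    ((hJ n ω hω).mono (le_max_left _ _)).unique hV hω.1
      ((hJ m ω hω).mono (le_max_right _ _)) (max_lt hn hm)
  have hev : ∀ᶠ ω in 𝓝[lowerHalfPlane] (0 : ℂ), ω ∈ lowerHalfPlane := self_mem_nhdsWithin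
  -- At zero energy, agreement on overlaps follows from uniqueness of the limit of `ω^l Φ` and `ω^l
  -- Ψ`.
  have hcompat₀ : ∀ (n m : ℕ) (u : ℝ), -(n : ℝ) < u → -(m : ℝ) < u →
      φ₀ n u = φ₀ m u ∧ ψ₀ n u = ψ₀ m u := fun n m u hn hm =>
    ⟨tendsto_nhds_unique_of_eventuallyEq (hL n u hn).1 (hL m u hm).1
      (hev.mono fun ω hω => by simp only [(hcompat ω hω n m u hn hm).1]),
    tendsto_nhds_unique_of_eventuallyEq (hL n u hn).2 (hL m u hm).2
      (hev.mono fun ω hω => by simp only [(hcompat ω hω n m u hn hm).2])⟩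
  refine ⟨fun ω hω => ?_, ?_⟩
  · obtain ⟨φ, ψ, h1, h2⟩ := exists_global_solution (fun n => (hJ n ω hω).sol) (hcompat ω hω)
    have hpos : ∀ᶠ u : ℝ in atTop, -((0 : ℕ) : ℝ) < u := eventually_gt_atTop _
    refine ⟨φ, isJostSolutionAtTop_of_isJostOn fun b => ⟨h1 b, ?_, ?_⟩, fun φ' hφ' => ?_⟩
    · exact (hJ 0 ω hω).tendsto_one.congr' (hpos.mono fun u hu => by simp only [(h2 0 u hu).1])
    · exact (hJ 0 ω hω).tendsto_zero.congr'
        (hpos.mono fun u hu => by simp only [(h2 0 u hu).1, (h2 0 u hu).2])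
    · funext u
      obtain ⟨n, hn⟩ := exists_nat_gt (-u)
      have hn' : -(n : ℝ) < u := by linarith
      rw [(h2 n u hn').1]
      exact ((hφ'.isJostOn _).unique hV hω.1 (hJ n ω hω) hn').1
  · obtain ⟨φ, ψ, h1, h2⟩ := exists_global_solution hS hcompat₀
    refine ⟨φ, isRadialSolution_of_isSolutionOn h1, ?_, I_pow_mul_Gamma l, fun F hF u => ?_⟩
    · refine (hA 0).congr' ?_
      have hpos : ∀ᶠ u : ℝ in atTop, -((0 : ℕ) : ℝ) < u := eventually_gt_atTop _
      exact hpos.mono fun u hu => by simp only [(h2 0 u hu).1]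
    · obtain ⟨n, hn⟩ := exists_nat_gt (-u)
      have hn' : -(n : ℝ) < u := by linarith
      have huniq := fun ω (hω : ω ∈ lowerHalfPlane) =>
        ((hF ω hω).isJostOn _).unique hV hω.1 (hJ n ω hω) hn'
      rw [deriv_eq_of_isSolutionOn h1, (h2 n u hn').1, (h2 n u hn').2]
      exact ⟨(hL n u hn').1.congr' (hev.mono fun ω hω => by simp only [(huniq ω hω).1]),
        (hL n u hn').2.congr' (hev.mono fun ω hω => by simp only [(huniq ω hω).2])⟩
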